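/- **Theorem 5.3.** A *variety of groups* is a class of groups closed under subgroups, homomorphic images and unrestricted direct products. Let $\mathfrak{B}$ be a variety. For a set $\Sigma$ let $\langle\mathfrak{w}\rangle$ (the subgroup generated by the laws) be the smallest normal subgroup $N$ of the free group $F(\Sigma)$ with $F(\Sigma)/N\in\mathfrak{B}$, and let $F_{\mathfrak{B}}(\Sigma)=F(\Sigma)/\langle\mathfrak{w}\rangle$. Let $\mathfrak{A}$ be the class of finitely presented groups in $\mathfrak{B}$, and assume that $\mathfrak{A}$ is a *variety of finitely presented groups*, i.e. that $F_{\mathfrak{B}}(\Sigma)\in\mathfrak{A}$ for every finite $\Sigma$. For a finite alphabet $\Sigma$, a group $\Gamma$ and homomorphisms $g,h\colon F(\Sigma)\to\Gamma$ put $\mathrm{Eq}(g,h)=\{x\in F(\Sigma)\mid g(x)=h(x)\}$. The *kernel-based Post Correspondence Problem (PCP)* asks, given $(\Sigma,\Gamma,g,h)$, whether the group $\mathrm{Eq}(g,h)/(\ker g\cap\ker h)$ is trivial. As inputs of algorithms, groups are given by finite presentations, elements by words in the generators, finitely generated subgroups by finite sets of words, and $g,h$ by words for the images of the letters of $\Sigma$.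 Suppose that the following hold. 1. There is an algorithm with input $(\Sigma,K,g,h)$, where $K\in\mathfrak{A}$ and $g,h\colon F(\Sigma)\to K$ are homomorphisms, and output a finite set $S\subset F(\Sigma)$ such that $\mathrm{Eq}(g,h)=\langle S,\mathfrak{w}\rangle$, the subgroup generated by $S$ and $\langle\mathfrak{w}\rangle$. 2. There is an algorithm with input a group $K\in\mathfrak{A}$, two finitely generated subgroups $A,B\le K$ and an element $x\in K$, which determines whether $x\in AB$. Then the PCP is decidable for virtually $\mathfrak{A}$ groups: there is one algorithm with input a finitely presented group $\Gamma$, a finite set of elements of $\Gamma$ generating a finite index subgroup that belongs to $\mathfrak{A}$, a finite alphabet $\Sigma$ and homomorphisms $g,h\colon F(\Sigma)\to\Gamma$, which determines whether $\mathrm{Eq}(g,h)/(\ker g\cap\ker h)$ is trivial. In particular, for every fixed group $\Gamma$ that has a finite index subgroup in $\mathfrak{A}$, and every finite tuple of generators of $\Gamma$ (in which the values of $g$ and $h$ are written as words), the PCP for $\Gamma$ is decidable. -/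

import Mathlib

/-! ## Varieties of groups -/

/-- A variety of groups: a class of groups closed under subgroups, homomorphic images (so in
particular under isomorphism) and unrestricted direct products. -/
structure GroupVariety where
  /-- the groups belonging to the variety -/
  Mem : ∀ (G : Type) [Group G], Prop
  subgroup_mem : ∀ (G : Type) [Group G] (H : Subgroup G), Mem G → Mem H
  image_mem : ∀ (G H : Type) [Group G] [Group H] (f : G →* H),
    Function.Surjective f → Mem G → Mem H
  pi_mem : ∀ (ι : Type) (G : ι → Type) [∀ i, Group (G i)], (∀ i, Mem (G i)) → Mem (∀ i, G i)

namespace GroupVariety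

/-- The subgroup `⟨w⟩` of the free group on `X` generated by the laws of the variety: the
smallest normal subgroup `N` of `F(X)` such that `F(X)/N` lies in the variety (that the infimum
below has this property is `mem_relFree`). -/
def lawSubgroup (V : GroupVariety) (X : Type) : Subgroup (FreeGroup X) :=
  sInf {N | ∃ _ : N.Normal, V.Mem (FreeGroup X ⧸ N)}

instance lawSubgroup_normal (V : GroupVariety) (X : Type) : (V.lawSubgroup X).Normal := by
  constructor
  intro n hn g
  simp only [lawSubgroup, Subgroup.mem_sInf, Set.mem_ofPred_eq] at hn ⊢
  rintro N ⟨hN, hV⟩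
  exact hN.conj_mem n (hn N ⟨hN, hV⟩) g

/-- The relatively free group `F_V(X) = F(X)/⟨w⟩` of the variety on the set `X`. -/
abbrev RelFree (V : GroupVariety) (X : Type) : Type := FreeGroup X ⧸ V.lawSubgroup X

/-- The relatively free group lies in the variety. -/
theorem mem_relFree (V : GroupVariety) (X : Type) : V.Mem (V.RelFree X) := by
  classical
  let ι : Type := {N : Subgroup (FreeGroup X) // ∃ _ : N.Normal, V.Mem (FreeGroup X ⧸ N)}
  have hn : ∀ i : ι, i.1.Normal := fun i => i.2.choose
  let f : FreeGroup X →* ∀ i : ι, FreeGroup X ⧸ i.1 := MonoidHom.pi fun i => QuotientGroup.mk' i.1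
  have hker : f.ker = V.lawSubgroup X := by
    ext x
    have hx : x ∈ f.ker ↔ ∀ i : ι, x ∈ i.1 := by
      rw [MonoidHom.mem_ker, funext_iff]
      exact forall_congr' fun i => QuotientGroup.eq_one_iff x
    rw [hx, lawSubgroup, Subgroup.mem_sInf]
    exact ⟨fun h N hN => h ⟨N, hN⟩, fun h i => h i.1 i.2⟩
  have h1 : V.Mem (∀ i : ι, FreeGroup X ⧸ i.1) := V.pi_mem ι _ fun i => i.2.choose_spec
  have h2 : V.Mem f.range := V.subgroup_mem _ f.range h1
  let e : (FreeGroup X ⧸ V.lawSubgroup X) ≃* f.range :=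
    (QuotientGroup.quotientMulEquivOfEq hker.symm).trans (QuotientGroup.quotientKerEquivRange f)
  exact V.image_mem _ _ e.symm.toMonoidHom e.symm.surjective h2

/-- The finitely presented groups of the variety. -/
def FPMem (V : GroupVariety) (G : Type) [Group G] : Prop :=
  V.Mem G ∧ Group.IsFinitelyPresented G

/-- The class `V.FPMem` is a variety of finitely presented groups (and not only a weak one): it
contains the free objects of `V` of finite rank. -/
def IsFPVariety (V : GroupVariety) : Prop :=
  ∀ n : ℕ, V.FPMem (V.RelFree (Fin n))

end GroupVariety

/-! ## Words, finite presentations and instances as inputs of algorithms -/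

/-- A word in the letters `x₀, x₁, …` and their inverses: `(i, true)` stands for `xᵢ` and
`(i, false)` for its inverse. -/
abbrev GWord : Type := List (ℕ × Bool)

/-- The value of a word at `n` elements of a group; letters with index `≥ n` are ignored, so that
every word is a word over an alphabet with `n` letters. -/
def GWord.val {n : ℕ} {G : Type} [Group G] (γ : Fin n → G) (w : GWord) : G :=
  FreeGroup.lift (fun i : ℕ => if h : i < n then γ ⟨i, h⟩ else 1) (FreeGroup.mk w)

/-- The subgroup generated by the values of a finite list of words. -/
def wordSubgroup {n : ℕ} {G : Type} [Group G] (γ : Fin n → G) (S : List GWord) : Subgroup G :=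
  Subgroup.closure {x | ∃ w ∈ S, w.val γ = x}

/-- A finite presentation: the number of generators and the list of relators. -/
abbrev FinPres : Type := ℕ × List GWord

namespace FinPres

/-- The relators as elements of the free group. -/
def rels (P : FinPres) : Set (FreeGroup (Fin P.1)) :=
  {r | ∃ w ∈ P.2, w.val FreeGroup.of = r}

/-- The group given by the presentation. -/
abbrev Grp (P : FinPres) : Type := PresentedGroup P.rels

/-- The generators of the presented group. -/
def gen (P : FinPres) (i : Fin P.1) : P.Grp := PresentedGroup.of i

end FinPres

/-- A pair of homomorphisms `g, h : F(Σ) → G`, where `Σ` has `k` letters: the list, of length `k`,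
of the pairs (word for `g(σ)`, word for `h(σ)`). -/
abbrev HomPair : Type := List (GWord × GWord)

namespace HomPair

variable {n : ℕ} {G : Type} [Group G]

/-- The homomorphism `g`. -/
def fstHom (L : HomPair) (γ : Fin n → G) : FreeGroup (Fin L.length) →* G :=
  FreeGroup.lift fun i => (L.get i).1.val γ

/-- The homomorphism `h`. -/
def sndHom (L : HomPair) (γ : Fin n → G) : FreeGroup (Fin L.length) →* G :=
  FreeGroup.lift fun i => (L.get i).2.val γ

/-- The equaliser `Eq(g, h)`. -/
def equaliser (L : HomPair) (γ : Fin n → G) : Subgroup (FreeGroup (Fin L.length)) :=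
  (L.fstHom γ).eqLocus (L.sndHom γ)

/-- The question of the kernel-based Post correspondence problem:
is the group `Eq(g, h) / (ker g ∩ ker h)` trivial? -/
def PCPTrivial (L : HomPair) (γ : Fin n → G) : Prop :=
  Subsingleton (L.equaliser γ ⧸ ((L.fstHom γ).ker ⊓ (L.sndHom γ).ker).subgroupOf (L.equaliser γ))

end HomPair

/-! ## Algorithms -/

/-- There is an algorithm which, on every input `a` with `Valid a`, halts with an output `b`
such that `Spec a b`; nothing is required on the other inputs. -/
def HasAlgorithm {α β : Type} [Primcodable α] [Primcodable β]
    (Valid : α → Prop) (Spec : α → β → Prop) : Prop :=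
  ∃ f : α →. β, Partrec f ∧ ∀ a, Valid a → ∃ b ∈ f a, Spec a b

/-- There is an algorithm which, on every input `a` with `Valid a`, halts and decides `Q a`. -/
def DecidableOn {α : Type} [Primcodable α] (Valid : α → Prop) (Q : α → Prop) : Prop :=
  HasAlgorithm Valid fun a (b : Bool) => b = true ↔ Q a

/-- An algorithm with input a finitely presented group `K` in the variety and homomorphisms
`g, h : F(Σ) → K`, and output a finite set `S ⊆ F(Σ)` with `Eq(g, h) = ⟨S, w⟩`, where `w` are the
laws of the variety. -/
def EqualiserAlgorithm (V : GroupVariety) : Prop :=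
  HasAlgorithm (α := FinPres × HomPair) (β := List GWord)
    (fun I => V.FPMem I.1.Grp)
    (fun I S => I.2.equaliser I.1.gen = wordSubgroup FreeGroup.of S ⊔ V.lawSubgroup (Fin I.2.length))

open scoped Pointwise in
/-- An algorithm with input a finitely presented group `K` in the variety, finite generating sets
of subgroups `A, B` of `K`, and an element `x` of `K`, which decides whether `x ∈ AB`. -/
def ProductMembershipAlgorithm (V : GroupVariety) : Prop :=
  DecidableOn (α := FinPres × List GWord × List GWord × GWord)
    (fun I => V.FPMem I.1.Grp)
    (fun I => I.2.2.2.val I.1.gen ∈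
      (wordSubgroup I.1.gen I.2.1 : Set I.1.Grp) * (wordSubgroup I.1.gen I.2.2.1 : Set I.1.Grp))

/-- The Post correspondence problem is decidable for virtually `V.FPMem` groups, by one algorithm
for all of them: the input is a finite presentation of a group `Γ`, a finite list of words which
generate a finite index subgroup of `Γ` in the class `V.FPMem`, and homomorphisms
`g, h : F(Σ) → Γ`. -/
def VirtuallyPCPDecidable (V : GroupVariety) : Prop :=
  DecidableOn (α := FinPres × List GWord × HomPair)
    (fun I => (wordSubgroup I.1.gen I.2.1).FiniteIndex ∧ V.FPMem (wordSubgroup I.1.gen I.2.1))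
    (fun I => I.2.2.PCPTrivial I.1.gen)

/-- The Post correspondence problem is decidable for the individual group `Γ`, whose elements are
given as words in the generators `γ`. -/
def PCPDecidableFor {n : ℕ} {Γ : Type} [Group Γ] (γ : Fin n → Γ) : Prop :=
  ComputablePred fun L : HomPair => L.PCPTrivial γ

/-! Let `K` be the finite index subgroup in the class. Two searches run in parallel: one for a proof
that the equaliser dies under `g` and `h`, one for an element of it that survives.

Put `F = g⁻¹(K) ∩ h⁻¹(K)`. It has finite index in `F(Σ)`, hence is generated by a finite list of
words `U`, and `g, h` induce homomorphisms `g', h'` into `K` from the free group with one letter for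
each word of `U`. A solution lies in one of finitely many cosets `tF`, and `g(tf) = h(tf)` means
`h(t)⁻¹g(t) = h(f)g(f)⁻¹`. For `y = h(t)⁻¹g(t)` in `K`, this is solvable if and only if `(1, y)`
lies in the product of the subgroup of all pairs `(g'(f), h'(f))` and the diagonal of `K × K`. As `K
× K` is again finitely presented and in the variety, the second algorithm answers the question
(`FinPres.mem_mul_sq_iff`).

The laws vanish in `K`, so `Eq(g', h') = ⟨S, w⟩` dies as soon as the finitely many elements of `S`
do. In a coset with solutions one element `x'` of `ker g ∩ ker h` is then enough: any other solution
`x` there has `x'⁻¹x` in the equaliser over `F`. This is a finite certificate of triviality, sound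
by `CosetTable.Locates.pcpTrivial_of_posCert` and complete by
`CosetTable.Locates.posCert_of_pcpTrivial`. A nontrivial solution can be recognised because the word
problem of `K` is the case `A = B = 1` of the second algorithm (`CosetTable.Locates.negCert_iff`).

Computations in `Γ` are carried out in `K` through a coset table. In the uniform statement the table
is not given; it is searched for together with finitely many equations in finitely presented groups,
a semidecidable condition, which force it to be correct
(`CosetTable.TableCert.exists_isCosetTable`). A correct table always has such equations
(`CosetTable.IsCosetTable.exists_tableCert`). -/

/-! ## Semidecidable predicates -/

/-- A predicate which is the projection of a primitive recursive one. -/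
def SigmaOne {α : Type} [Primcodable α] (p : α → Prop) : Prop :=
  ∃ q : α × ℕ → Prop, PrimrecPred q ∧ ∀ a, p a ↔ ∃ n, q (a, n)

namespace SigmaOne

variable {α β : Type} [Primcodable α] [Primcodable β]

theorem of_eq {p q : α → Prop} (hp : SigmaOne p) (h : ∀ a, p a ↔ q a) : SigmaOne q :=
  (funext fun a => propext (h a) : p = q) ▸ hp

theorem of_primrec {p : α → Prop} (hp : PrimrecPred p) : SigmaOne p :=
  ⟨fun x => p x.1, hp.comp Primrec.fst, fun a => by simp⟩

theorem comp {p : β → Prop} (hp : SigmaOne p) {f : α → β} (hf : Primrec f) :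
    SigmaOne fun a => p (f a) := by
  obtain ⟨q, hq, h⟩ := hp
  exact ⟨fun x => q (f x.1, x.2), hq.comp ((hf.comp Primrec.fst).pair Primrec.snd),
    fun a => h (f a)⟩

theorem and {p₁ p₂ : α → Prop} (h₁ : SigmaOne p₁) (h₂ : SigmaOne p₂) :
    SigmaOne fun a => p₁ a ∧ p₂ a := by
  obtain ⟨q₁, hq₁, h₁⟩ := h₁
  obtain ⟨q₂, hq₂, h₂⟩ := h₂
  have hu : Primrec fun x : α × ℕ => x.2.unpair := Primrec.unpair.comp Primrec.snd
  refine ⟨fun x => q₁ (x.1, x.2.unpair.1) ∧ q₂ (x.1, x.2.unpair.2),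
    (hq₁.comp (Primrec.fst.pair (Primrec.fst.comp hu))).and
      (hq₂.comp (Primrec.fst.pair (Primrec.snd.comp hu))), fun a => ?_⟩
  refine (and_congr (h₁ a) (h₂ a)).trans ?_
  constructor
  · rintro ⟨⟨n, hn⟩, m, hm⟩
    exact ⟨Nat.pair n m, by simpa using ⟨hn, hm⟩⟩
  · rintro ⟨n, hn, hm⟩
    exact ⟨⟨_, hn⟩, _, hm⟩

theorem or {p₁ p₂ : α → Prop} (h₁ : SigmaOne p₁) (h₂ : SigmaOne p₂) :
    SigmaOne fun a => p₁ a ∨ p₂ a := by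
  obtain ⟨q₁, hq₁, h₁⟩ := h₁
  obtain ⟨q₂, hq₂, h₂⟩ := h₂
  refine ⟨fun x => q₁ x ∨ q₂ x, hq₁.or hq₂, fun a => ?_⟩
  exact (or_congr (h₁ a) (h₂ a)).trans exists_or.symm

theorem ex {p : α → β → Prop} (hp : SigmaOne fun x : α × β => p x.1 x.2) :
    SigmaOne fun a => ∃ b, p a b := by
  obtain ⟨q, hq, h⟩ := hp
  have hR : PrimrecRel fun (b : β) (x : α × ℕ) => q ((x.1, b), x.2.unpair.2) :=
    hq.comp (((Primrec.fst.comp Primrec.snd).pair Primrec.fst).pair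
      (Primrec.snd.comp (Primrec.unpair.comp (Primrec.snd.comp Primrec.snd))))
  -- The new witness codes `b` together with the old witness; a number that decodes to no `b` gives
  -- the empty list and so never counts.
  refine ⟨fun x => ∃ b ∈ (Encodable.decode (α := β) x.2.unpair.1).toList,
    q ((x.1, b), x.2.unpair.2), hR.exists_mem_list.comp (Primrec.optionToList.comp
      (Primrec.decode.comp (Primrec.fst.comp (Primrec.unpair.comp Primrec.snd)))) Primrec.id,
    fun a => ?_⟩
  constructor
  · rintro ⟨b, hb⟩
    obtain ⟨n, hn⟩ := (h (a, b)).1 hb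
    exact ⟨Nat.pair (Encodable.encode b) n, b, by simpa using hn⟩
  · rintro ⟨n, b, -, hb⟩
    exact ⟨b, (h (a, b)).2 ⟨_, hb⟩⟩

theorem forall_mem {p : α → β → Prop} (hp : SigmaOne fun x : α × β => p x.1 x.2)
    {f : α → List β} (hf : Primrec f) : SigmaOne fun a => ∀ b ∈ f a, p a b := by
  obtain ⟨q, hq, h⟩ := hp
  have hR : PrimrecRel fun (n : ℕ) (x : α × β) => q (x, n) :=
    hq.comp (Primrec.snd.pair Primrec.fst)
  have hS : PrimrecRel fun (b : β) (x : α × ℕ) => ∃ n ∈ List.range x.2, q ((x.1, b), n) :=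
    hR.exists_mem_list.comp (Primrec.list_range.comp (Primrec.snd.comp Primrec.snd))
      ((Primrec.fst.comp Primrec.snd).pair Primrec.fst)
  refine ⟨fun x => ∀ b ∈ f x.1, ∃ n ∈ List.range x.2, q ((x.1, b), n),
    hS.forall_mem_list.comp (hf.comp Primrec.fst) Primrec.id, fun a => ?_⟩
  constructor
  · intro H
    choose! n hn using fun b hb => (h (a, b)).1 (H b hb)
    -- The sum bounds all the individual witnesses, so finitely many unbounded searches share one
    -- bound.
    refine ⟨((f a).map n).sum + 1, fun b hb => ⟨n b, ?_, hn b hb⟩⟩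
    exact List.mem_range.2 (Nat.lt_succ_of_le (List.single_le_sum (by simp) _
      (List.mem_map_of_mem hb)))
  · rintro ⟨N, hN⟩ b hb
    obtain ⟨n, -, hn⟩ := hN b hb
    exact (h (a, b)).2 ⟨n, hn⟩

theorem mem_list : PrimrecPred fun x : β × List β => x.1 ∈ x.2 := by
  refine PrimrecPred.of_eq (PrimrecRel.exists_mem_list (Primrec.eq (α := β)) |>.comp
    Primrec.snd Primrec.fst) fun x => ?_
  simp

theorem exists_mem {p : α → β → Prop} (hp : SigmaOne fun x : α × β => p x.1 x.2)
    {f : α → List β} (hf : Primrec f) : SigmaOne fun a => ∃ b ∈ f a, p a b :=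
  ex ((of_primrec (mem_list.comp (Primrec.snd.pair (hf.comp Primrec.fst)))).and hp)

-- Kleene's normal form: evaluation of a fixed code with bounded fuel is primitive recursive, and
-- the fuel serves as the witness.
open Nat.Partrec in
theorem graph {f : α →. β} (hf : Partrec f) : SigmaOne fun x : α × β => x.2 ∈ f x.1 := by
  obtain ⟨c, hc⟩ := Code.exists_code.1 hf
  refine ⟨fun x => Code.evaln x.2 c (Encodable.encode x.1.1) = some (Encodable.encode x.1.2), ?_,
    fun a => ?_⟩
  · exact Primrec.eq.comp (Code.primrec_evaln.comp ((Primrec.snd.pair (Primrec.const c)).pair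
      (Primrec.encode.comp (Primrec.fst.comp Primrec.fst))))
      (Primrec.option_some.comp (Primrec.encode.comp (Primrec.snd.comp Primrec.fst)))
  · have : Encodable.encode a.2 ∈ Code.eval c (Encodable.encode a.1) ↔ a.2 ∈ f a.1 := by
      simp [hc]
    exact this.symm.trans Code.evaln_complete

theorem rePred {p : α → Prop} (hp : SigmaOne p) : REPred p := by
  obtain ⟨q, ⟨hd, hq⟩, h⟩ := hp
  have : Partrec fun a => Nat.rfind fun n => Part.some (decide (q (a, n))) :=
    Partrec.rfind (hq.to_comp.partrec)
  refine this.dom_re.of_eq fun a => ?_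
  refine Iff.trans ?_ (h a).symm
  refine (Nat.rfind_dom (p := fun n => Part.some (decide (q (a, n))))).trans ?_
  simp

end SigmaOne

/-- A problem is decidable on the valid inputs if its positive and its negative instances are
semidecidable among them. -/
theorem DecidableOn.of_sigmaOne {α : Type} [Primcodable α] {Valid Q p p' : α → Prop}
    (hp : SigmaOne p) (hp' : SigmaOne p') (h : ∀ a, Valid a → (p a ↔ Q a))
    (h' : ∀ a, Valid a → (p' a ↔ ¬ Q a)) : DecidableOn Valid Q := by
  -- On invalid inputs both searches may succeed; unlike `Partrec.merge`, `Partrec.merge'` asks for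
  -- no consistency between them.
  obtain ⟨k, hk, H⟩ := Partrec.merge' (hp.rePred.map (Computable.const true).to₂)
    (hp'.rePred.map (Computable.const false).to₂)
  refine ⟨k, hk, fun a ha => ?_⟩
  obtain ⟨H₁, H₂⟩ := H a
  have hd : (k a).Dom := by
    rw [H₂]
    by_cases hQ : Q a
    · left; exact ⟨(h a ha).2 hQ, trivial⟩
    · right; exact ⟨(h' a ha).2 hQ, trivial⟩
  refine ⟨(k a).get hd, Part.get_mem hd, ?_⟩
  rcases H₁ _ (Part.get_mem hd) with hx | hx
  · simp only [Part.mem_map_iff, Part.mem_assert_iff, Part.mem_some_iff] at hx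
    obtain ⟨_, ⟨hx, -⟩, hb⟩ := hx
    simp [← hb, (h a ha).1 hx]
  · simp only [Part.mem_map_iff, Part.mem_assert_iff, Part.mem_some_iff] at hx
    obtain ⟨_, ⟨hx, -⟩, hb⟩ := hx
    simp [← hb, (h' a ha).1 hx]

/-! ## Words -/

namespace GWord

variable {n : ℕ} {G H : Type} [Group G] [Group H] (γ : Fin n → G)

@[simp] theorem val_nil : GWord.val γ [] = 1 := by
  simp [GWord.val, ← FreeGroup.one_eq_mk]

@[simp] theorem val_append (u v : GWord) : GWord.val γ (u ++ v) = u.val γ * v.val γ := by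
  simp [GWord.val, ← FreeGroup.mul_mk]

@[simp] theorem val_invRev (u : GWord) : GWord.val γ (FreeGroup.invRev u) = (u.val γ)⁻¹ := by
  simp [GWord.val, ← FreeGroup.inv_mk]

theorem val_cons (l : ℕ × Bool) (w : GWord) :
    GWord.val γ (l :: w) = GWord.val γ [l] * w.val γ := by
  rw [← List.singleton_append, val_append]

theorem val_letter (i : Fin n) : GWord.val γ [((i : ℕ), true)] = γ i := by
  simp [GWord.val]

theorem val_letter_inv (i : Fin n) : GWord.val γ [((i : ℕ), false)] = (γ i)⁻¹ := by
  simp [GWord.val]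

theorem val_letter_false (i : ℕ) : GWord.val γ [(i, false)] = (GWord.val γ [(i, true)])⁻¹ := by
  simp [GWord.val]

theorem val_letter_of_le {l : ℕ × Bool} (h : n ≤ l.1) : GWord.val γ [l] = 1 := by
  obtain ⟨i, _ | _⟩ := l <;> simp [GWord.val, Nat.not_lt.2 h]

theorem map_val (f : G →* H) (w : GWord) : f (w.val γ) = w.val fun i => f (γ i) := by
  have : f.comp (FreeGroup.lift fun i : ℕ => if h : i < n then γ ⟨i, h⟩ else 1) =
      FreeGroup.lift fun i : ℕ => if h : i < n then f (γ ⟨i, h⟩) else 1 := by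
    ext i
    by_cases h : i < n <;> simp [h]
  exact DFunLike.congr_fun this _

theorem val_of (w : GWord) : FreeGroup.lift γ (w.val FreeGroup.of) = w.val γ := by
  rw [map_val]
  simp

theorem exists_val_of (x : FreeGroup (Fin n)) : ∃ w : GWord, w.val FreeGroup.of = x := by
  refine ⟨x.toWord.map fun l => ((l.1 : ℕ), l.2), ?_⟩
  conv_rhs => rw [← FreeGroup.mk_toWord (x := x)]
  generalize x.toWord = L
  induction L with
  | nil => simp [← FreeGroup.one_eq_mk]
  | cons l L ih =>
    rw [List.map_cons, val_cons, ih]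
    change _ = FreeGroup.mk ([l] ++ L)
    rw [← FreeGroup.mul_mk]
    obtain ⟨i, _ | _⟩ := l
    · rw [val_letter_inv]; rfl
    · rw [val_letter]; rfl

theorem val_mem_closure (w : GWord) : w.val γ ∈ Subgroup.closure (Set.range γ) := by
  induction w with
  | nil => simp
  | cons l w ih =>
    rw [val_cons]
    refine mul_mem ?_ ih
    obtain ⟨i, b⟩ := l
    by_cases h : i < n
    · have := Subgroup.subset_closure (Set.mem_range_self (f := γ) ⟨i, h⟩)
      cases b
      · exact (val_letter_inv γ ⟨i, h⟩).symm ▸ inv_mem this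
      · exact (val_letter γ ⟨i, h⟩).symm ▸ this
    · rw [val_letter_of_le γ (not_lt.1 h)]
      exact one_mem _

theorem mem_closure_iff {x : G} :
    x ∈ Subgroup.closure (Set.range γ) ↔ ∃ w : GWord, w.val γ = x := by
  constructor
  · intro hx
    rw [← FreeGroup.range_lift_eq_closure] at hx
    obtain ⟨y, rfl⟩ := hx
    obtain ⟨w, rfl⟩ := exists_val_of y
    exact ⟨w, (val_of γ w).symm⟩
  · rintro ⟨w, rfl⟩
    exact val_mem_closure γ w

/-- The word obtained from `v` by replacing the letter `xᵢ` by the `i`-th word of the list. -/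
def subst (σ : List GWord) (v : GWord) : GWord :=
  v.flatMap fun l => cond l.2 (σ.getD l.1 []) (FreeGroup.invRev (σ.getD l.1 []))

/-- The bound `hσ` reconciles the two conventions for stray letters: an index `≥ k` has value `1` on
the right, and on the left it falls off the list and is replaced by the empty word. -/
theorem val_subst_of {k : ℕ} {δ : Fin k → G} {σ : List GWord} (hσ : σ.length ≤ k)
    (h : ∀ i : Fin k, (σ.getD i []).val γ = δ i) (v : GWord) :
    (subst σ v).val γ = v.val δ := by
  induction v with
  | nil => simp [subst]
  | cons l v ih =>
    have : subst σ (l :: v) =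
        cond l.2 (σ.getD l.1 []) (FreeGroup.invRev (σ.getD l.1 [])) ++ subst σ v := by
      simp [subst]
    rw [this, val_append, ih, val_cons δ]
    congr 1
    obtain ⟨i, b⟩ := l
    by_cases hi : i < k
    · cases b
      · exact (val_invRev γ _).trans ((congrArg _ (h ⟨i, hi⟩)).trans
          (val_letter_inv δ ⟨i, hi⟩).symm)
      · exact (h ⟨i, hi⟩).trans (val_letter δ ⟨i, hi⟩).symm
    · rw [val_letter_of_le δ (not_lt.1 hi),
        List.getD_eq_default _ _ (hσ.trans (not_lt.1 hi))]
      cases b <;> simp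

theorem val_subst (σ : List GWord) (v : GWord) :
    (subst σ v).val γ = v.val fun i : Fin σ.length => (σ[i] : GWord).val γ :=
  val_subst_of γ le_rfl (fun i => by simp) v

theorem range_getElem_val (S : List GWord) :
    Set.range (fun i : Fin S.length => (S[i] : GWord).val γ) = {x | ∃ w ∈ S, w.val γ = x} := by
  ext x
  constructor
  · rintro ⟨i, rfl⟩
    exact ⟨S[i], List.getElem_mem _, rfl⟩
  · rintro ⟨w, hw, rfl⟩
    obtain ⟨i, hi, rfl⟩ := List.mem_iff_getElem.1 hw
    exact ⟨⟨i, hi⟩, rfl⟩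

theorem mem_wordSubgroup_iff {S : List GWord} {x : G} :
    x ∈ wordSubgroup γ S ↔ ∃ v : GWord, (subst S v).val γ = x := by
  rw [wordSubgroup, ← range_getElem_val, mem_closure_iff]
  simp only [val_subst]

theorem invRev_prim : Primrec (FreeGroup.invRev : GWord → GWord) :=
  Primrec.list_reverse.comp (Primrec.list_map Primrec.id
    ((Primrec.fst.pair (Primrec.not.comp Primrec.snd)).comp Primrec.snd).to₂)

theorem getD_prim : Primrec₂ fun (σ : List GWord) (i : ℕ) => σ.getD i [] :=
  Primrec.list_getD []

theorem subst_prim : Primrec₂ subst := by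
  have h : Primrec fun x : (List GWord × GWord) × (ℕ × Bool) => x.1.1.getD x.2.1 [] :=
    getD_prim.comp (Primrec.fst.comp Primrec.fst) (Primrec.fst.comp Primrec.snd)
  exact Primrec.list_flatMap Primrec.snd
    (Primrec.cond (Primrec.snd.comp Primrec.snd) h (invRev_prim.comp h)).to₂

/-- Free reduction is a right fold whose step either cancels or prepends a letter. It turns equality
in a free group into a primitive recursive test. -/
theorem reduce_prim : Primrec (FreeGroup.reduce : GWord → GWord) := by
  have h : PrimrecPred fun x : (ℕ × Bool) × (ℕ × Bool) => x.1.1 = x.2.1 ∧ x.1.2 = !x.2.2 :=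
    (Primrec.eq.comp (Primrec.fst.comp Primrec.fst) (Primrec.fst.comp Primrec.snd)).and
      (Primrec.eq.comp (Primrec.snd.comp Primrec.fst)
        (Primrec.not.comp (Primrec.snd.comp Primrec.snd)))
  let step (l : ℕ × Bool) (s : GWord) : GWord :=
    List.casesOn s [l] fun l' s' => if l.1 = l'.1 ∧ l.2 = !l'.2 then s' else l :: l' :: s'
  have hstep : Primrec₂ step := by
    refine Primrec.list_casesOn (h := fun (x : (ℕ × Bool) × GWord) (y : (ℕ × Bool) × GWord) =>
      if x.1.1 = y.1.1 ∧ x.1.2 = !y.1.2 then y.2 else x.1 :: y.1 :: y.2) Primrec.snd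
      (Primrec.list_cons.comp Primrec.fst (Primrec.const [])) ?_
    refine Primrec.ite (h.comp ((Primrec.fst.comp Primrec.fst).pair
      (Primrec.fst.comp Primrec.snd))) (Primrec.snd.comp Primrec.snd) ?_
    exact Primrec.list_cons.comp (Primrec.fst.comp Primrec.fst)
      (Primrec.list_cons.comp (Primrec.fst.comp Primrec.snd) (Primrec.snd.comp Primrec.snd))
  refine (Primrec.list_foldr (h := fun (_ : GWord) (y : (ℕ × Bool) × GWord) => step y.1 y.2)
    Primrec.id (Primrec.const []) (hstep.comp (Primrec.fst.comp Primrec.snd)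
      (Primrec.snd.comp Primrec.snd))).of_eq fun w => ?_
  induction w with
  | nil => rfl
  | cons l w ih =>
    rw [FreeGroup.reduce.cons, ← ih]
    rfl

/-- The word without its letters of index at least `n`. -/
def restrict (n : ℕ) (w : GWord) : GWord := w.filter (·.1 < n)

/-- The free group on `Fin n` embeds in the one on `ℕ`, so words for all ranks `n` can be reduced by
one and the same function. -/
theorem map_val_of (w : GWord) :
    FreeGroup.map (Fin.val : Fin n → ℕ) (w.val FreeGroup.of) = FreeGroup.mk (restrict n w) := by
  induction w with
  | nil => simp [restrict, ← FreeGroup.one_eq_mk]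
  | cons l w ih =>
    rw [val_cons, map_mul, ih]
    obtain ⟨i, b⟩ := l
    by_cases h : i < n
    · have : restrict n ((i, b) :: w) = [(i, b)] ++ restrict n w := by simp [restrict, h]
      rw [this, ← FreeGroup.mul_mk]
      congr 1
      cases b
      · exact (congrArg _ (val_letter_inv _ ⟨i, h⟩)).trans (by simp; rfl)
      · exact (congrArg _ (val_letter _ ⟨i, h⟩)).trans (by simp; rfl)
    · have : restrict n ((i, b) :: w) = restrict n w := by simp [restrict, h]
      rw [this, val_letter_of_le _ (not_lt.1 h)]
      simp

theorem reduce_restrict_eq_iff {u w : GWord} :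
    FreeGroup.reduce (restrict n u) = FreeGroup.reduce (restrict n w) ↔
      u.val (FreeGroup.of : Fin n → _) = w.val FreeGroup.of := by
  rw [← (FreeGroup.map_injective Fin.val_injective).eq_iff, map_val_of, map_val_of]
  exact ⟨FreeGroup.reduce.exact, FreeGroup.reduce.sound⟩

theorem restrict_prim : Primrec₂ restrict := by
  have hR : PrimrecRel fun (l : ℕ × Bool) (n : ℕ) => l.1 < n :=
    Primrec.nat_lt.comp (Primrec.fst.comp Primrec.fst) Primrec.snd
  exact hR.listFilter.comp Primrec.snd Primrec.fst

end GWord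

/-! ### The word problem of a finitely presented group is semidecidable, uniformly in the
presentation. -/

namespace FinPres

open GWord

theorem val_gen (P : FinPres) (w : GWord) :
    w.val P.gen = PresentedGroup.mk P.rels (w.val FreeGroup.of) := by
  rw [map_val]
  rfl

theorem exists_val_gen (P : FinPres) (x : P.Grp) : ∃ w : GWord, w.val P.gen = x := by
  obtain ⟨y, rfl⟩ := PresentedGroup.mk_surjective _ x
  obtain ⟨w, rfl⟩ := exists_val_of y
  exact ⟨w, P.val_gen w⟩

theorem closure_range_gen (P : FinPres) : Subgroup.closure (Set.range P.gen) = ⊤ :=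
  PresentedGroup.closure_range_of _

/-- A conjugate of a relator or of the inverse of a relator. -/
def conjRel (P : FinPres) (c : GWord × ℕ × Bool) : GWord :=
  c.1 ++ cond c.2.2 (P.2.getD c.2.1 []) (FreeGroup.invRev (P.2.getD c.2.1 [])) ++
    FreeGroup.invRev c.1

theorem val_gen_of_mem (P : FinPres) {w : GWord} (hw : w ∈ P.2) : w.val P.gen = 1 := by
  rw [val_gen]
  exact PresentedGroup.one_of_mem ⟨w, hw, rfl⟩

/-- An index beyond the list of relators stands for the empty relator, so that every list of triples
is a legitimate certificate. -/
theorem val_conjRel (P : FinPres) (c : GWord × ℕ × Bool) : (P.conjRel c).val P.gen = 1 := by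
  have h : (P.2.getD c.2.1 []).val P.gen = 1 := by
    by_cases hc : c.2.1 < P.2.length
    · rw [List.getD_eq_getElem _ _ hc]
      exact P.val_gen_of_mem (List.getElem_mem _)
    · rw [List.getD_eq_default _ _ (not_lt.1 hc), val_nil]
  obtain ⟨u, i, _ | _⟩ := c <;> simp_all [conjRel]

/-- The normal closure of the relators consists of the products of conjugates of relators and their
inverses. The list `cs` records such a product, and comparing it with `w` is only a free reduction.
-/
theorem val_gen_eq_one_iff (P : FinPres) (w : GWord) :
    w.val P.gen = 1 ↔ ∃ cs : List (GWord × ℕ × Bool),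
      FreeGroup.reduce (restrict P.1 (cs.flatMap P.conjRel)) =
        FreeGroup.reduce (restrict P.1 w) := by
  simp only [reduce_restrict_eq_iff]
  constructor
  · intro h
    rw [val_gen, PresentedGroup.mk_eq_one_iff, Subgroup.normalClosure] at h
    generalize (w.val FreeGroup.of : FreeGroup (Fin P.1)) = x at h
    have key : ∀ x ∈ Group.conjugatesOfSet P.rels, ∃ u i,
        (P.conjRel (u, i, true)).val FreeGroup.of = x ∧
        (P.conjRel (u, i, false)).val FreeGroup.of = x⁻¹ := by
      intro x hx
      obtain ⟨r, ⟨w, hw, rfl⟩, hc⟩ := Group.mem_conjugatesOfSet_iff.1 hx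
      obtain ⟨g, rfl⟩ := isConj_iff.1 hc
      obtain ⟨u, rfl⟩ := exists_val_of g
      obtain ⟨i, hi, rfl⟩ := List.mem_iff_getElem.1 hw
      exact ⟨u, i, by simp [conjRel, hi, mul_assoc], by simp [conjRel, hi, mul_assoc]⟩
    induction h using Subgroup.closure_induction_left with
    | one => exact ⟨[], by simp⟩
    | mul_left x hx y hy ih =>
      obtain ⟨cs, rfl⟩ := ih
      obtain ⟨u, i, h, -⟩ := key x hx
      exact ⟨(u, i, true) :: cs, by simp [h]⟩
    | inv_mul_cancel x hx y hy ih =>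
      obtain ⟨cs, rfl⟩ := ih
      obtain ⟨u, i, -, h⟩ := key x hx
      exact ⟨(u, i, false) :: cs, by simp [h]⟩
  · rintro ⟨cs, h⟩
    rw [val_gen, ← h, ← val_gen]
    clear h
    induction cs with
    | nil => simp
    | cons c cs ih => simp [val_conjRel, ih]

theorem sigmaOne_val_gen_eq_one :
    SigmaOne fun x : FinPres × GWord => x.2.val x.1.gen = 1 := by
  have hr : Primrec fun x : (FinPres × GWord) × (GWord × ℕ × Bool) =>
      x.1.1.2.getD x.2.2.1 [] :=
    getD_prim.comp (Primrec.snd.comp (Primrec.fst.comp Primrec.fst))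
      (Primrec.fst.comp (Primrec.snd.comp Primrec.snd))
  have hc : Primrec₂ fun (x : FinPres × GWord) (c : GWord × ℕ × Bool) => x.1.conjRel c := by
    have hu : Primrec fun x : (FinPres × GWord) × (GWord × ℕ × Bool) => x.2.1 :=
      Primrec.fst.comp Primrec.snd
    exact Primrec.list_append.comp (Primrec.list_append.comp hu
      (Primrec.cond (Primrec.snd.comp (Primrec.snd.comp Primrec.snd)) hr (invRev_prim.comp hr)))
      (invRev_prim.comp hu)
  have hn : Primrec fun x : (FinPres × GWord) × List (GWord × ℕ × Bool) => x.1.1.1 :=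
    Primrec.fst.comp (Primrec.fst.comp Primrec.fst)
  refine SigmaOne.of_eq (SigmaOne.ex (SigmaOne.of_primrec ?_))
    fun x => (x.1.val_gen_eq_one_iff x.2).symm
  refine Primrec.eq.comp (reduce_prim.comp (restrict_prim.comp hn ?_))
    (reduce_prim.comp (restrict_prim.comp hn (Primrec.snd.comp Primrec.fst)))
  exact Primrec.list_flatMap Primrec.snd
    (hc.comp (Primrec.fst.comp Primrec.fst) Primrec.snd).to₂

end FinPres

/-! ## The presentation of the square of a finitely presented group -/

namespace GWord

variable {n : ℕ} {G : Type} [Group G]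

/-- The word in the letters `x₀, x₂, x₄, …` corresponding to a given word. -/
def evens (w : GWord) : GWord := w.map fun l => (2 * l.1, l.2)

/-- The word in the letters `x₁, x₃, x₅, …` corresponding to a given word. -/
def odds (w : GWord) : GWord := w.map fun l => (2 * l.1 + 1, l.2)

theorem val_map_letters {m : ℕ} (γ : Fin n → G) (δ : Fin m → G) (f : ℕ → ℕ)
    (hf : ∀ i, GWord.val γ [(f i, true)] = GWord.val δ [(i, true)]) (w : GWord) :
    GWord.val γ (w.map fun l => (f l.1, l.2)) = w.val δ := by
  induction w with
  | nil => simp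
  | cons l w ih =>
    rw [List.map_cons, val_cons, ih, val_cons δ]
    congr 1
    obtain ⟨i, _ | _⟩ := l
    · rw [val_letter_false, hf, ← val_letter_false]
    · exact hf i

theorem val_evens (γ : Fin (2 * n) → G) (w : GWord) :
    (evens w).val γ = w.val fun i : Fin n => γ ⟨2 * i, by lia⟩ := by
  refine val_map_letters _ _ (2 * ·) (fun i => ?_) w
  by_cases h : i < n
  · exact (val_letter γ ⟨2 * i, by lia⟩).trans (val_letter (fun i : Fin n => γ ⟨2 * i, by lia⟩) ⟨i, h⟩).symm
  · rw [val_letter_of_le _ (by simp; lia), val_letter_of_le _ (by simpa using h)]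

theorem val_odds (γ : Fin (2 * n) → G) (w : GWord) :
    (odds w).val γ = w.val fun i : Fin n => γ ⟨2 * i + 1, by lia⟩ := by
  refine val_map_letters _ _ (2 * · + 1) (fun i => ?_) w
  by_cases h : i < n
  · exact (val_letter γ ⟨2 * i + 1, by lia⟩).trans (val_letter (fun i : Fin n => γ ⟨2 * i + 1, by lia⟩) ⟨i, h⟩).symm
  · rw [val_letter_of_le _ (by simp; lia), val_letter_of_le _ (by simpa using h)]

theorem commute_val {γ : Fin n → G} {g : G} (h : ∀ i, Commute (γ i) g) (w : GWord) :
    Commute (w.val γ) g := by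
  have : w.val γ ∈ Subgroup.centralizer {g} :=
    (Subgroup.closure_le _).2 (by
      rintro _ ⟨i, rfl⟩
      exact Subgroup.mem_centralizer_singleton_iff.2 (h i)) (val_mem_closure γ w)
  exact Subgroup.mem_centralizer_singleton_iff.1 this

theorem evens_prim : Primrec evens :=
  Primrec.list_map Primrec.id (((Primrec.nat_double.comp Primrec.fst).pair
    Primrec.snd).comp Primrec.snd).to₂

theorem odds_prim : Primrec odds :=
  Primrec.list_map Primrec.id (((Primrec.nat_double_succ.comp Primrec.fst).pair
    Primrec.snd).comp Primrec.snd).to₂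

end GWord

namespace FinPres

open GWord

variable {G : Type} [Group G]

/-- The homomorphism from a presented group given by the images of the generators. -/
def hom (P : FinPres) (δ : Fin P.1 → G) (h : ∀ w ∈ P.2, w.val δ = 1) : P.Grp →* G :=
  PresentedGroup.toGroup (f := δ) (by
    rintro _ ⟨w, hw, rfl⟩
    rw [val_of, h w hw])

theorem hom_val (P : FinPres) (δ : Fin P.1 → G) (h : ∀ w ∈ P.2, w.val δ = 1) (w : GWord) :
    P.hom δ h (w.val P.gen) = w.val δ := by
  rw [map_val]
  congr 1
  ext i
  exact PresentedGroup.toGroup.of _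

/-- The commutators of the even with the odd letters. -/
def commRels (n : ℕ) : List GWord :=
  (List.range n).flatMap fun i => (List.range n).map fun j =>
    [(2 * i, true), (2 * j + 1, true), (2 * i, false), (2 * j + 1, false)]

/-- A presentation of the direct square. -/
def sq (P : FinPres) : FinPres :=
  (2 * P.1, P.2.map evens ++ P.2.map odds ++ commRels P.1)

variable (P : FinPres)

/-- The generators of the first factor of the direct square. -/
def sqFst (i : Fin P.1) : P.sq.Grp := P.sq.gen ⟨2 * i, by simp only [sq]; lia⟩

/-- The generators of the second factor of the direct square. -/
def sqSnd (i : Fin P.1) : P.sq.Grp := P.sq.gen ⟨2 * i + 1, by simp only [sq]; lia⟩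

theorem val_evens_sq (w : GWord) : (evens w).val P.sq.gen = w.val P.sqFst :=
  val_evens (n := P.1) P.sq.gen w

theorem val_odds_sq (w : GWord) : (odds w).val P.sq.gen = w.val P.sqSnd :=
  val_odds (n := P.1) P.sq.gen w

theorem commute_sq (i j : Fin P.1) : Commute (P.sqFst i) (P.sqSnd j) := by
  have h := P.sq.val_gen_of_mem
    (w := [(2 * i, true), (2 * j + 1, true), (2 * i, false), (2 * j + 1, false)])
    (by simp only [sq, commRels, List.mem_append, List.mem_flatMap, List.mem_map, List.mem_range]
        exact Or.inr ⟨i, i.2, j, j.2, rfl⟩)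
  have hi := val_letter P.sq.gen ⟨2 * i, by simp only [sq]; lia⟩
  have hj := val_letter P.sq.gen ⟨2 * j + 1, by simp only [sq]; lia⟩
  rw [val_cons, val_cons _ (2 * (j : ℕ) + 1, true), val_cons _ (2 * (i : ℕ), false),
    val_letter_false, val_letter_false] at h
  change GWord.val P.sq.gen [(2 * (i : ℕ), true)] = P.sqFst i at hi
  change GWord.val P.sq.gen [(2 * (j : ℕ) + 1, true)] = P.sqSnd j at hj
  rw [hi, hj] at h
  rw [Commute, SemiconjBy, ← mul_inv_eq_one, mul_inv_rev]
  simpa [mul_assoc] using h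

/-- The inclusion of the first factor in the direct square. -/
def sqInl : P.Grp →* P.sq.Grp := P.hom P.sqFst fun w hw => by
  rw [← val_evens_sq]
  exact P.sq.val_gen_of_mem (List.mem_append_left _ (List.mem_append_left _ (List.mem_map_of_mem hw)))

/-- The inclusion of the second factor in the direct square. -/
def sqInr : P.Grp →* P.sq.Grp := P.hom P.sqSnd fun w hw => by
  rw [← val_odds_sq]
  exact P.sq.val_gen_of_mem (List.mem_append_left _ (List.mem_append_right _ (List.mem_map_of_mem hw)))

/-- The homomorphism from the direct product of two copies to the group presented by `P.sq`. -/
def sqHom : P.Grp × P.Grp →* P.sq.Grp :=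
  MonoidHom.noncommCoprod P.sqInl P.sqInr fun a b => by
    obtain ⟨u, rfl⟩ := P.exists_val_gen a
    obtain ⟨v, rfl⟩ := P.exists_val_gen b
    rw [sqInl, sqInr, hom_val, hom_val]
    exact commute_val (fun i => (commute_val (fun j => (P.commute_sq i j).symm) v).symm) u

theorem sqHom_val (u v : GWord) :
    P.sqHom (u.val P.gen, v.val P.gen) = (evens u ++ odds v).val P.sq.gen := by
  rw [val_append, val_evens_sq, val_odds_sq]
  simp [sqHom, sqInl, sqInr, hom_val]

theorem sqHom_surjective : Function.Surjective P.sqHom := by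
  rw [← MonoidHom.range_eq_top, eq_top_iff, ← closure_range_gen, Subgroup.closure_le]
  rintro _ ⟨⟨i, hi⟩, rfl⟩
  simp only [sq] at hi
  obtain ⟨j, rfl | rfl⟩ := Nat.even_or_odd' i
  · refine ⟨(GWord.val P.gen [(j, true)], GWord.val P.gen []), ?_⟩
    rw [sqHom_val]
    exact val_letter P.sq.gen ⟨2 * j, hi⟩
  · refine ⟨(GWord.val P.gen [], GWord.val P.gen [(j, true)]), ?_⟩
    rw [sqHom_val]
    exact val_letter P.sq.gen ⟨2 * j + 1, hi⟩

/-- The assignment `δ`, which sends even generators to the first factor and odd ones to the second,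
kills the relators of `P.sq`; the resulting homomorphism is a left inverse. -/
theorem sqHom_injective : Function.Injective P.sqHom := by
  let δ : Fin P.sq.1 → P.Grp × P.Grp := fun i =>
    if Even i.1 then (GWord.val P.gen [(i / 2, true)], 1)
    else (1, GWord.val P.gen [(i / 2, true)])
  have he : ∀ w : GWord, (evens w).val δ = (w.val P.gen, 1) := fun w => by
    refine (val_evens (n := P.1) δ w).trans ?_
    have := map_val P.gen (MonoidHom.inl P.Grp P.Grp) w
    refine Eq.trans ?_ this.symm
    congr 1
    ext i : 1
    simpa [δ] using val_letter P.gen i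
  have ho : ∀ w : GWord, (odds w).val δ = (1, w.val P.gen) := fun w => by
    refine (val_odds (n := P.1) δ w).trans ?_
    have := map_val P.gen (MonoidHom.inr P.Grp P.Grp) w
    refine Eq.trans ?_ this.symm
    congr 1
    ext i : 1
    have h2 : (2 * (i : ℕ) + 1) / 2 = i := by lia
    simpa [δ, h2] using val_letter P.gen i
  have hr : ∀ w ∈ P.sq.2, w.val δ = 1 := by
    intro w hw
    simp only [sq, commRels, List.mem_append, List.mem_map, List.mem_flatMap, List.mem_range] at hw
    obtain (⟨u, hu, rfl⟩ | ⟨u, hu, rfl⟩) | ⟨i, hi, j, hj, rfl⟩ := hw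
    · rw [he, P.val_gen_of_mem hu]; rfl
    · rw [ho, P.val_gen_of_mem hu]; rfl
    · have h₁ := he [(i, true)]
      have h₂ := ho [(j, true)]
      simp only [evens, odds, List.map_cons, List.map_nil] at h₁ h₂
      rw [val_cons, val_cons _ (2 * j + 1, true), val_cons _ (2 * i, false),
        val_letter_false, val_letter_false, h₁, h₂]
      simp
  refine Function.LeftInverse.injective (g := P.sq.hom δ hr) ?_
  rintro ⟨a, b⟩
  obtain ⟨u, rfl⟩ := P.exists_val_gen a
  obtain ⟨v, rfl⟩ := P.exists_val_gen b
  rw [sqHom_val, hom_val, val_append, he, ho]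
  simp

theorem finite_rels : Finite P.rels := by
  have : P.rels = (fun w : GWord => w.val FreeGroup.of) '' {w | w ∈ P.2} := rfl
  rw [this]
  exact (P.2.finite_toSet.image _).to_subtype

theorem isFinitelyPresented : Group.IsFinitelyPresented P.Grp := by
  have := P.finite_rels
  infer_instance

open scoped Pointwise in
/-- The solvability of `y = h(f) g(f)⁻¹` as a membership in a product of two subgroups of the
direct square: those generated by the pairs `(g(σ), h(σ))` and by the diagonal. -/
theorem mem_mul_sq_iff (L : HomPair) (y : GWord) :
    (odds y).val P.sq.gen ∈
      (wordSubgroup P.sq.gen (L.map fun p => evens p.1 ++ odds p.2) : Set P.sq.Grp) *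
      (wordSubgroup P.sq.gen ((List.range P.1).map fun j => [(2 * j, true), (2 * j + 1, true)]) :
        Set P.sq.Grp) ↔
      ∃ f, y.val P.gen = L.sndHom P.gen f * (L.fstHom P.gen f)⁻¹ := by
  have hy : (odds y).val P.sq.gen = P.sqHom (1, y.val P.gen) := by
    have := P.sqHom_val [] y
    simpa [evens] using this.symm
  have hA : ∀ x, x ∈ wordSubgroup P.sq.gen (L.map fun p => evens p.1 ++ odds p.2) ↔
      ∃ f, P.sqHom (L.fstHom P.gen f, L.sndHom P.gen f) = x := by
    intro x
    have key : ∀ v : GWord, (subst (L.map fun p => evens p.1 ++ odds p.2) v).val P.sq.gen =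
        P.sqHom (L.fstHom P.gen (v.val FreeGroup.of), L.sndHom P.gen (v.val FreeGroup.of)) := by
      intro v
      have := map_val FreeGroup.of (P.sqHom.comp ((L.fstHom P.gen).prod (L.sndHom P.gen))) v
      refine Eq.trans ?_ this.symm
      refine val_subst_of _ (by simp) (fun i => ?_) v
      rw [List.getD_eq_getElem _ _ (by simp)]
      simp [HomPair.fstHom, HomPair.sndHom, sqHom_val]
    rw [mem_wordSubgroup_iff]
    constructor
    · rintro ⟨v, rfl⟩
      exact ⟨_, (key v).symm⟩
    · rintro ⟨f, rfl⟩
      obtain ⟨v, rfl⟩ := exists_val_of f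
      exact ⟨v, key v⟩
  have hB : ∀ x, x ∈ wordSubgroup P.sq.gen
        ((List.range P.1).map fun j => [(2 * j, true), (2 * j + 1, true)]) ↔
      ∃ a, P.sqHom (a, a) = x := by
    intro x
    have key : ∀ v : GWord, (subst ((List.range P.1).map fun j =>
        [(2 * j, true), (2 * j + 1, true)]) v).val P.sq.gen =
        P.sqHom (v.val P.gen, v.val P.gen) := by
      intro v
      have := map_val P.gen (P.sqHom.comp ((MonoidHom.id _).prod (MonoidHom.id _))) v
      refine Eq.trans ?_ this.symm
      refine val_subst_of _ (by simp) (fun i => ?_) v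
      rw [List.getD_eq_getElem _ _ (by simp)]
      have := P.sqHom_val [((i : ℕ), true)] [((i : ℕ), true)]
      rw [val_letter] at this
      simpa [evens, odds] using this.symm
    rw [mem_wordSubgroup_iff]
    constructor
    · rintro ⟨v, rfl⟩
      exact ⟨_, (key v).symm⟩
    · rintro ⟨a, rfl⟩
      obtain ⟨v, rfl⟩ := P.exists_val_gen a
      exact ⟨v, key v⟩
  -- An equation `(1, y) = (g(f), h(f)) (n, n)` forces `n = g(f)⁻¹`, hence `y = h(f) g(f)⁻¹`.
  rw [hy, Set.mem_mul]
  constructor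
  · rintro ⟨a, ha, b, hb, hab⟩
    obtain ⟨f, rfl⟩ := (hA _).1 ha
    obtain ⟨n, rfl⟩ := (hB _).1 hb
    rw [← map_mul] at hab
    have := P.sqHom_injective hab
    simp only [Prod.mk_mul_mk, Prod.mk.injEq] at this
    refine ⟨f, ?_⟩
    rw [← this.2, eq_inv_of_mul_eq_one_right this.1]
  · rintro ⟨f, hf⟩
    refine ⟨_, (hA _).2 ⟨f, rfl⟩, _, (hB _).2 ⟨(L.fstHom P.gen f)⁻¹, rfl⟩, ?_⟩
    rw [← map_mul, hf]
    simp

theorem sq_prim : Primrec sq := by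
  have hi : Primrec fun x : (ℕ × ℕ) × ℕ => 2 * x.1.2 :=
    Primrec.nat_double.comp (Primrec.snd.comp Primrec.fst)
  have hj : Primrec fun x : (ℕ × ℕ) × ℕ => 2 * x.2 + 1 := Primrec.nat_double_succ.comp Primrec.snd
  have hc : Primrec commRels := Primrec.list_flatMap Primrec.list_range
    (Primrec.list_map (Primrec.list_range.comp Primrec.fst)
      (Primrec.list_cons.comp (hi.pair (Primrec.const true))
      (Primrec.list_cons.comp (hj.pair (Primrec.const true))
      (Primrec.list_cons.comp (hi.pair (Primrec.const false))
      (Primrec.list_cons.comp (hj.pair (Primrec.const false)) (Primrec.const []))))).to₂).to₂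
  exact (Primrec.nat_double.comp Primrec.fst).pair (Primrec.list_append.comp
    (Primrec.list_append.comp
      (Primrec.list_map Primrec.snd (evens_prim.comp Primrec.snd).to₂)
      (Primrec.list_map Primrec.snd (odds_prim.comp Primrec.snd).to₂))
    (hc.comp Primrec.fst))

end FinPres

/-- This makes the presented square a legal input of the membership algorithm. For the variety it is
enough that it is an image of a power of the group. -/
theorem GroupVariety.FPMem.sq {V : GroupVariety} {P : FinPres} (h : V.FPMem P.Grp) :
    V.FPMem P.sq.Grp := by
  refine ⟨?_, P.sq.isFinitelyPresented⟩
  have h₁ : V.Mem (Bool → P.Grp) := V.pi_mem Bool (fun _ => P.Grp) fun _ => h.1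
  refine V.image_mem _ _ (P.sqHom.comp ((Pi.evalMonoidHom (fun _ : Bool => P.Grp) true).prod
    (Pi.evalMonoidHom (fun _ : Bool => P.Grp) false))) (P.sqHom_surjective.comp ?_) h₁
  rintro ⟨a, b⟩
  exact ⟨fun i => cond i a b, rfl⟩

/-! ## Coset tables with values in a finitely presented subgroup -/

/-- A coset table: the number of letters, a presentation of the subgroup, and the list of the
values `(j, u)` describing how a letter moves the `i`-th coset representative: it becomes the
`j`-th one times `u`. -/
abbrev CosetTable : Type := ℕ × FinPres × List (ℕ × GWord)

namespace CosetTable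

open GWord

/-- The entry of the table for a letter and a coset; letters which are out of range act
trivially. -/
def look (T : CosetTable) (l : ℕ × Bool) (i : ℕ) : ℕ × GWord :=
  -- The entry for a letter and a coset sits at the position given by the code of the pair.
  if l.1 < T.1 then T.2.2.getD (Encodable.encode (l, i)) (0, []) else (i, [])

/-- The coset reached from coset `i` by a word, and the corresponding element of the subgroup. -/
def run (T : CosetTable) (w : GWord) (i : ℕ) : ℕ × GWord :=
  -- Words act from the left, so the last letter moves first: if `w cᵢ = cₘ s` and `l cₘ = cⱼ u`,
  -- then `l w cᵢ = cⱼ u s`.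
  w.foldr (fun l s => ((T.look l s.1).1, (T.look l s.1).2 ++ s.2)) (i, [])

@[simp] theorem run_nil (T : CosetTable) (i : ℕ) : T.run [] i = (i, []) := rfl

theorem run_cons (T : CosetTable) (l : ℕ × Bool) (w : GWord) (i : ℕ) :
    T.run (l :: w) i =
      ((T.look l (T.run w i).1).1, (T.look l (T.run w i).1).2 ++ (T.run w i).2) := rfl

theorem look_prim : Primrec fun x : CosetTable × (ℕ × Bool) × ℕ => x.1.look x.2.1 x.2.2 := by
  have hl : Primrec fun x : CosetTable × (ℕ × Bool) × ℕ => x.2.1 :=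
    Primrec.fst.comp Primrec.snd
  have hi : Primrec fun x : CosetTable × (ℕ × Bool) × ℕ => x.2.2 :=
    Primrec.snd.comp Primrec.snd
  exact Primrec.ite (Primrec.nat_lt.comp (Primrec.fst.comp hl) (Primrec.fst.comp Primrec.fst))
    ((Primrec.list_getD (0, [])).comp (Primrec.snd.comp (Primrec.snd.comp Primrec.fst))
      (Primrec.encode.comp (hl.pair hi))) (hi.pair (Primrec.const []))

theorem run_prim : Primrec fun x : CosetTable × GWord × ℕ => x.1.run x.2.1 x.2.2 := by
  have h : Primrec fun x : (CosetTable × GWord × ℕ) × (ℕ × Bool) × (ℕ × GWord) =>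
      x.1.1.look x.2.1 x.2.2.1 :=
    look_prim.comp (g := fun x : (CosetTable × GWord × ℕ) × (ℕ × Bool) × (ℕ × GWord) =>
        (x.1.1, x.2.1, x.2.2.1))
      ((Primrec.fst.comp Primrec.fst).pair ((Primrec.fst.comp Primrec.snd).pair
      (Primrec.fst.comp (Primrec.snd.comp Primrec.snd))))
  have h₂ : Primrec₂ fun (x : CosetTable × GWord × ℕ) (y : (ℕ × Bool) × (ℕ × GWord)) =>
      ((x.1.look y.1 y.2.1).1, (x.1.look y.1 y.2.1).2 ++ y.2.2) :=
    ((Primrec.fst.comp h).pair (Primrec.list_append.comp (Primrec.snd.comp h)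
      (Primrec.snd.comp (Primrec.snd.comp Primrec.snd)))).to₂
  have h₀ : Primrec fun x : CosetTable × GWord × ℕ => (x.2.2, ([] : GWord)) :=
    (Primrec.snd.comp Primrec.snd).pair (Primrec.const [])
  have hw : Primrec fun x : CosetTable × GWord × ℕ => x.2.1 := Primrec.fst.comp Primrec.snd
  have := Primrec.list_foldr hw h₀ h₂
  exact this

/-- The coset of the element given by a word. -/
def pos (T : CosetTable) (w : GWord) : ℕ := (T.run w 0).1

/-- The word in the generators of the subgroup for an element of the subgroup given by a word in
the generators of the group. -/
def rewrite (T : CosetTable) (w : GWord) : GWord := (T.run w 0).2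

theorem pos_prim : Primrec₂ pos := by
  have := Primrec.fst.comp (run_prim.comp (Primrec.fst.pair (Primrec.snd.pair (Primrec.const 0))))
  exact this

theorem rewrite_prim : Primrec₂ rewrite := by
  have := Primrec.snd.comp (run_prim.comp (Primrec.fst.pair (Primrec.snd.pair (Primrec.const 0))))
  exact this

variable {n : ℕ} {Γ : Type} [Group Γ]

/-- The coset table decides membership in the image of the finite index embedding `ι` and computes
preimages. -/
structure Locates (T : CosetTable) (γ : Fin n → Γ) (ι : T.2.1.Grp →* Γ) : Prop where
  injective : Function.Injective ι
  finiteIndex : ι.range.FiniteIndex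
  mem_iff : ∀ w : GWord, w.val γ ∈ ι.range ↔ T.pos w = 0
  val_eq : ∀ w : GWord, T.pos w = 0 → w.val γ = ι ((T.rewrite w).val T.2.1.gen)

/-- The table shows that a word is trivial. -/
def IsOne (T : CosetTable) (w : GWord) : Prop :=
  T.pos w = 0 ∧ (T.rewrite w).val T.2.1.gen = 1

theorem Locates.isOne_iff {T : CosetTable} {γ : Fin n → Γ} {ι : T.2.1.Grp →* Γ}
    (h : T.Locates γ ι) (w : GWord) : T.IsOne w ↔ w.val γ = 1 := by
  constructor
  · rintro ⟨h0, h1⟩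
    rw [h.val_eq w h0, h1, map_one]
  · intro h1
    have h0 : T.pos w = 0 := (h.mem_iff w).1 (h1 ▸ one_mem _)
    refine ⟨h0, h.injective ?_⟩
    rw [← h.val_eq w h0, h1, map_one]

theorem sigmaOne_isOne : SigmaOne fun x : CosetTable × GWord => x.1.IsOne x.2 :=
  (SigmaOne.of_primrec (Primrec.eq.comp pos_prim (Primrec.const 0))).and
    (FinPres.sigmaOne_val_gen_eq_one.comp
      ((Primrec.fst.comp (Primrec.snd.comp Primrec.fst)).pair rewrite_prim))

end CosetTable

/-! ### The correspondence problem in terms of words. -/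

namespace HomPair

open GWord

variable {n : ℕ} {G : Type} [Group G] (L : HomPair)

/-- The word for the value of `g`. -/
def fstWord (w : GWord) : GWord := subst (L.map Prod.fst) w

/-- The word for the value of `h`. -/
def sndWord (w : GWord) : GWord := subst (L.map Prod.snd) w

theorem val_fstWord (γ : Fin n → G) (w : GWord) :
    (L.fstWord w).val γ = L.fstHom γ (w.val FreeGroup.of) := by
  rw [map_val]
  refine val_subst_of _ (by simp) (fun i => ?_) w
  rw [List.getD_eq_getElem _ _ (by simp)]
  simp [fstHom]

theorem val_sndWord (γ : Fin n → G) (w : GWord) :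
    (L.sndWord w).val γ = L.sndHom γ (w.val FreeGroup.of) := by
  rw [map_val]
  refine val_subst_of _ (by simp) (fun i => ?_) w
  rw [List.getD_eq_getElem _ _ (by simp)]
  simp [sndHom]

theorem fstWord_prim : Primrec₂ fstWord :=
  subst_prim.comp (Primrec.list_map Primrec.fst (Primrec.fst.comp Primrec.snd).to₂) Primrec.snd

theorem sndWord_prim : Primrec₂ sndWord :=
  subst_prim.comp (Primrec.list_map Primrec.fst (Primrec.snd.comp Primrec.snd).to₂) Primrec.snd

/-- On the equaliser `g` and `h` agree, so an element of it in `ker g` is automatically in `ker h`.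
-/
theorem pcpTrivial_iff (γ : Fin n → G) :
    L.PCPTrivial γ ↔ ∀ x, L.fstHom γ x = L.sndHom γ x → L.fstHom γ x = 1 := by
  rw [PCPTrivial, QuotientGroup.subsingleton_iff, Subgroup.subgroupOf_eq_top]
  constructor
  · intro h x hx
    exact (h (show x ∈ L.equaliser γ from hx)).1
  · intro h x hx
    have hx' : L.fstHom γ x = L.sndHom γ x := hx
    exact ⟨h x hx', (hx' ▸ h x hx' : _ = _)⟩

end HomPair

/-! ## Deciding the correspondence problem from a coset table -/

open GWord

/-- Where an algorithm is known to halt with the right answer, the event that it outputs `false` is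
a semidecidable form of the negation. -/
theorem Part.false_mem_iff {x : Part Bool} {Q : Prop} (h : ∃ b ∈ x, (b = true ↔ Q)) :
    false ∈ x ↔ ¬ Q := by
  obtain ⟨b, hb, h⟩ := h
  rw [← h]
  constructor
  · intro h'
    simp [Part.mem_unique hb h']
  · intro h'
    rw [Bool.not_eq_true] at h'
    exact h' ▸ hb

/-- A free group is treated as a presentation without relators, so that equations in `F(Σ)` fall
under the same semidecision procedure. -/
theorem FinPres.val_gen_free_eq_one_iff (k : ℕ) (w : GWord) :
    w.val (FinPres.gen (k, [])) = 1 ↔ w.val (FreeGroup.of : Fin k → _) = 1 := by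
  have : FinPres.rels (k, []) = ∅ := by simp [FinPres.rels]
  rw [FinPres.val_gen, PresentedGroup.mk_eq_one_iff, this, Subgroup.normalClosure_empty,
    Subgroup.mem_bot]

theorem Subgroup.exists_wordSubgroup_eq {k : ℕ} (H : Subgroup (FreeGroup (Fin k))) [Group.FG H] :
    ∃ U : List GWord, wordSubgroup FreeGroup.of U = H := by
  obtain ⟨S, rfl⟩ := (Group.fg_iff_subgroup_fg H).1 inferInstance
  choose f hf using fun x : FreeGroup (Fin k) => exists_val_of x
  refine ⟨S.toList.map f, ?_⟩
  rw [wordSubgroup]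
  congr 1
  ext x
  simp [hf]

/-- The letters `x₀, …, xₖ₋₁` and their inverses. -/
def letters (k : ℕ) : List (ℕ × Bool) := (List.range k).flatMap fun i => [(i, true), (i, false)]

theorem mem_letters {k : ℕ} {l : ℕ × Bool} : l ∈ letters k ↔ l.1 < k := by
  obtain ⟨i, _ | _⟩ := l <;> simp [letters]

theorem letters_prim : Primrec letters := by
  have : Primrec₂ fun (_ i : ℕ) => [(i, true), (i, false)] :=
    (Primrec.list_cons.comp (Primrec.snd.pair (Primrec.const true))
      (Primrec.list_cons.comp (Primrec.snd.pair (Primrec.const false)) (Primrec.const []))).to₂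
  exact Primrec.list_flatMap Primrec.list_range this

/-- The quotient by `ker f` is isomorphic to a subgroup of `G`, so `ker f` is one of the subgroups
being intersected. -/
theorem GroupVariety.lawSubgroup_le_ker {V : GroupVariety} {X G : Type} [Group G] (hG : V.Mem G)
    (f : FreeGroup X →* G) : V.lawSubgroup X ≤ f.ker :=
  sInf_le ⟨inferInstance, V.image_mem _ _ (QuotientGroup.quotientKerEquivRange f).symm.toMonoidHom
    (QuotientGroup.quotientKerEquivRange f).symm.surjective (V.subgroup_mem _ f.range hG)⟩

namespace CosetTable

variable (T : CosetTable) (L : HomPair)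

/-- The pair of homomorphisms obtained by restricting to words whose values lie in the
subgroup. -/
def restrictPair (U : List GWord) : HomPair :=
  U.map fun u => (T.rewrite (L.fstWord u), T.rewrite (L.sndWord u))

/-- The word for `h(t)⁻¹ g(t)`. -/
def quotWord (L : HomPair) (t : GWord) : GWord := FreeGroup.invRev (L.sndWord t) ++ L.fstWord t

/-- The query to the membership algorithm which asks whether the word `y` has the form
`h(f) g(f)⁻¹`. -/
def productQuery (P : FinPres) (L : HomPair) (y : GWord) :
    FinPres × List GWord × List GWord × GWord :=
  (P.sq, L.map fun p => evens p.1 ++ odds p.2,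
    (List.range P.1).map fun j => [(2 * j, true), (2 * j + 1, true)], odds y)

variable (f₁ : FinPres × HomPair →. List GWord)
  (f₂ : FinPres × List GWord × List GWord × GWord →. Bool)

/-- The table and the membership algorithm show that a word is not trivial. -/
def IsNotOne (w : GWord) : Prop :=
  -- With both subgroups trivial, the membership algorithm solves the word problem of the subgroup.
  T.pos w ≠ 0 ∨ false ∈ f₂ (T.2.1, [], [], T.rewrite w)

/-- A certificate that there is a solution of the correspondence problem. -/
def NegCert : Prop :=
  ∃ w, T.IsOne (L.fstWord w ++ FreeGroup.invRev (L.sndWord w)) ∧ T.IsNotOne f₂ (L.fstWord w)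

/-- A certificate that the coset of `t` contains no solution of the correspondence problem. -/
def CosetCert (U : List GWord) (t : GWord) : Prop :=
  T.pos (quotWord L t) ≠ 0 ∨
  false ∈ f₂ (productQuery T.2.1 (T.restrictPair L U) (T.rewrite (quotWord L t))) ∨
  -- This alternative only supplies a base point of `ker g ∩ ker h` in the coset. The other
  -- solutions there differ from it by elements of the equaliser over `U`, which `PosCert` controls
  -- through `S`.
  ∃ v, T.IsOne (L.fstWord (t ++ subst U v)) ∧ T.IsOne (L.sndWord (t ++ subst U v))

/-- The words `R` represent all cosets of the subgroup of the free group generated by `U`. -/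
def CoverCert (k : ℕ) (U R : List GWord) : Prop :=
  [] ∈ R ∧ ∀ t ∈ R, ∀ l ∈ letters k, ∃ t' ∈ R, ∃ v,
    GWord.val (FinPres.gen (k, [])) (l :: t ++ FreeGroup.invRev (t' ++ subst U v)) = 1

/-- A certificate that there is no solution of the correspondence problem. -/
def PosCert : Prop :=
  -- The words `U` need not generate all of `F`: it suffices that `g` and `h` map them into the
  -- subgroup and that finitely many cosets of `⟨U⟩` cover the free group.
  ∃ U R S, (∀ u ∈ U, T.pos (L.fstWord u) = 0 ∧ T.pos (L.sndWord u) = 0) ∧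
    CoverCert L.length U R ∧ S ∈ f₁ (T.2.1, T.restrictPair L U) ∧
    (∀ s ∈ S, T.IsOne (L.fstWord (subst U s))) ∧ ∀ t ∈ R, T.CosetCert L f₂ U t

variable {f₁ f₂ T L}

/-- The union of the cosets `t⟨U⟩` contains `1` and is stable under left multiplication by letters
and their inverses. -/
theorem CoverCert.exists_eq {k : ℕ} {U R : List GWord} (h : CoverCert k U R) (w : GWord) :
    ∃ t ∈ R, ∃ v, w.val (FreeGroup.of : Fin k → _) = (t ++ subst U v).val FreeGroup.of := by
  induction w with
  | nil => exact ⟨[], h.1, [], by simp [subst]⟩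
  | cons l w ih =>
    obtain ⟨t, ht, v, e⟩ := ih
    by_cases hl : l.1 < k
    · obtain ⟨t', ht', v', e'⟩ := h.2 t ht l (mem_letters.2 hl)
      rw [FinPres.val_gen_free_eq_one_iff, val_append, val_invRev, mul_inv_eq_one] at e'
      refine ⟨t', ht', v' ++ v, ?_⟩
      have hs : subst U (v' ++ v) = subst U v' ++ subst U v := by simp [subst]
      rw [hs, ← List.append_assoc, val_append, ← e', val_cons, e, val_cons _ l t, val_append,
        mul_assoc]
    · exact ⟨t, ht, v, by rw [val_cons, val_letter_of_le _ (not_lt.1 hl), one_mul, e]⟩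

theorem get_restrictPair (U : List GWord) (i : Fin (T.restrictPair L U).length)
    (hi : i.1 < U.length) : (T.restrictPair L U).get i =
      (T.rewrite (L.fstWord U[i.1]), T.rewrite (L.sndWord U[i.1])) := by
  rw [List.get_eq_getElem]
  exact List.getElem_map _

section

variable {n : ℕ} {Γ : Type} [Group Γ] {γ : Fin n → Γ} {ι : T.2.1.Grp →* Γ}

/-- The restricted pair lives on the free group with one letter per word of `U`, so `U` need not be
a free basis; through `ι` it is `g` preceded by the substitution of these words. -/
theorem Locates.fstHom_restrictPair (hT : T.Locates γ ι) {U : List GWord}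
    (hU : ∀ u ∈ U, T.pos (L.fstWord u) = 0) (v : GWord) :
    ι ((T.restrictPair L U).fstHom T.2.1.gen (v.val FreeGroup.of)) =
      L.fstHom γ ((subst U v).val FreeGroup.of) := by
  rw [map_val, map_val, val_subst_of FreeGroup.of (k := (T.restrictPair L U).length)
    (δ := fun i => (U.getD i []).val FreeGroup.of) (by simp [restrictPair]) (fun _ => rfl), map_val]
  congr 1
  ext i
  have hi : i.1 < U.length := by simpa [restrictPair] using i.2
  rw [← HomPair.val_fstWord, List.getD_eq_getElem _ _ hi,
    hT.val_eq _ (hU _ (List.getElem_mem hi)), HomPair.fstHom, FreeGroup.lift_apply_of, get_restrictPair]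

theorem Locates.sndHom_restrictPair (hT : T.Locates γ ι) {U : List GWord}
    (hU : ∀ u ∈ U, T.pos (L.sndWord u) = 0) (v : GWord) :
    ι ((T.restrictPair L U).sndHom T.2.1.gen (v.val FreeGroup.of)) =
      L.sndHom γ ((subst U v).val FreeGroup.of) := by
  rw [map_val, map_val, val_subst_of FreeGroup.of (k := (T.restrictPair L U).length)
    (δ := fun i => (U.getD i []).val FreeGroup.of) (by simp [restrictPair]) (fun _ => rfl), map_val]
  congr 1
  ext i
  have hi : i.1 < U.length := by simpa [restrictPair] using i.2
  rw [← HomPair.val_sndWord, List.getD_eq_getElem _ _ hi,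
    hT.val_eq _ (hU _ (List.getElem_mem hi)), HomPair.sndHom, FreeGroup.lift_apply_of, get_restrictPair]

theorem val_quotWord (t : GWord) : (quotWord L t).val γ =
    (L.sndHom γ (t.val FreeGroup.of))⁻¹ * L.fstHom γ (t.val FreeGroup.of) := by
  rw [quotWord, val_append, val_invRev, HomPair.val_fstWord, HomPair.val_sndWord]

open scoped Pointwise in
/-- The specification of the algorithm `f₂`. -/
def DecidesProduct (V : GroupVariety)
    (f₂ : FinPres × List GWord × List GWord × GWord →. Bool) : Prop :=
  ∀ I, V.FPMem I.1.Grp → ∃ b ∈ f₂ I, (b = true ↔ I.2.2.2.val I.1.gen ∈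
      (wordSubgroup I.1.gen I.2.1 : Set I.1.Grp) * (wordSubgroup I.1.gen I.2.2.1 : Set I.1.Grp))

/-- The specification of the algorithm `f₁`. -/
def ComputesEqualiser (V : GroupVariety) (f₁ : FinPres × HomPair →. List GWord) : Prop :=
  ∀ I, V.FPMem I.1.Grp → ∃ S ∈ f₁ I,
    I.2.equaliser I.1.gen = wordSubgroup FreeGroup.of S ⊔ V.lawSubgroup (Fin I.2.length)

variable {V : GroupVariety}

open scoped Pointwise in
theorem Locates.isNotOne_iff (hT : T.Locates γ ι) (hV : V.FPMem T.2.1.Grp)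
    (h₂ : DecidesProduct V f₂) (w : GWord) : T.IsNotOne f₂ w ↔ w.val γ ≠ 1 := by
  have h : false ∈ f₂ (T.2.1, [], [], T.rewrite w) ↔ ¬ (T.rewrite w).val T.2.1.gen ∈
      (wordSubgroup T.2.1.gen [] : Set T.2.1.Grp) * (wordSubgroup T.2.1.gen [] : Set T.2.1.Grp) :=
    Part.false_mem_iff (h₂ (T.2.1, [], [], T.rewrite w) hV)
  have hb : wordSubgroup T.2.1.gen [] = ⊥ := by simp [wordSubgroup]
  simp only [hb, Subgroup.coe_bot, Set.singleton_mul_singleton, mul_one,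
    Set.mem_singleton_iff] at h
  rw [IsNotOne, h, ← not_iff_not, not_or, not_not, not_not, not_not]
  exact hT.isOne_iff w

theorem Locates.negCert_iff (hT : T.Locates γ ι) (hV : V.FPMem T.2.1.Grp)
    (h₂ : DecidesProduct V f₂) : T.NegCert L f₂ ↔ ¬ L.PCPTrivial γ := by
  rw [HomPair.pcpTrivial_iff]
  push Not
  simp only [NegCert, hT.isOne_iff, hT.isNotOne_iff hV h₂, val_append, val_invRev,
    HomPair.val_fstWord, HomPair.val_sndWord, mul_inv_eq_one]
  constructor
  · rintro ⟨w, h⟩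
    exact ⟨_, h⟩
  · rintro ⟨x, h⟩
    obtain ⟨w, rfl⟩ := exists_val_of x
    exact ⟨w, h⟩

/-- The first two alternatives of the certificate together say exactly that the coset contains no
solution, which turns the disjunction with the third into an implication. -/
theorem Locates.cosetCert_iff (hT : T.Locates γ ι) (hV : V.FPMem T.2.1.Grp)
    (h₂ : DecidesProduct V f₂) {U : List GWord}
    (hU : ∀ u ∈ U, T.pos (L.fstWord u) = 0 ∧ T.pos (L.sndWord u) = 0) (t : GWord) :
    T.CosetCert L f₂ U t ↔
      ((∃ v, L.fstHom γ ((t ++ subst U v).val FreeGroup.of) =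
          L.sndHom γ ((t ++ subst U v).val FreeGroup.of)) →
        ∃ v, L.fstHom γ ((t ++ subst U v).val FreeGroup.of) = 1 ∧
          L.sndHom γ ((t ++ subst U v).val FreeGroup.of) = 1) := by
  have h : false ∈ f₂ (productQuery T.2.1 (T.restrictPair L U) (T.rewrite (quotWord L t))) ↔
      ¬ ∃ f, (T.rewrite (quotWord L t)).val T.2.1.gen =
        (T.restrictPair L U).sndHom T.2.1.gen f *
          ((T.restrictPair L U).fstHom T.2.1.gen f)⁻¹ :=
    (Part.false_mem_iff (h₂ (productQuery T.2.1 (T.restrictPair L U)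
      (T.rewrite (quotWord L t))) hV.sq)).trans
      (not_congr (T.2.1.mem_mul_sq_iff (T.restrictPair L U) _))
  have hf := hT.fstHom_restrictPair (fun u hu => (hU u hu).1)
  have hs := hT.sndHom_restrictPair (fun u hu => (hU u hu).2)
  have key : (∃ v, L.fstHom γ ((t ++ subst U v).val FreeGroup.of) =
        L.sndHom γ ((t ++ subst U v).val FreeGroup.of)) ↔
      T.pos (quotWord L t) = 0 ∧ ∃ f, (T.rewrite (quotWord L t)).val T.2.1.gen =
        (T.restrictPair L U).sndHom T.2.1.gen f *
          ((T.restrictPair L U).fstHom T.2.1.gen f)⁻¹ := by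
    have e : ∀ v, L.fstHom γ ((t ++ subst U v).val FreeGroup.of) =
        L.sndHom γ ((t ++ subst U v).val FreeGroup.of) ↔ (quotWord L t).val γ =
        ι ((T.restrictPair L U).sndHom T.2.1.gen (v.val FreeGroup.of) *
          ((T.restrictPair L U).fstHom T.2.1.gen (v.val FreeGroup.of))⁻¹) := by
      intro v
      rw [map_mul, map_inv, hf, hs, val_quotWord, val_append, map_mul, map_mul,
        eq_mul_inv_iff_mul_eq, mul_assoc, inv_mul_eq_iff_eq_mul]
    simp only [e]
    constructor
    · rintro ⟨v, hv⟩
      have h0 : T.pos (quotWord L t) = 0 := (hT.mem_iff _).1 (hv ▸ ⟨_, rfl⟩)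
      exact ⟨h0, _, hT.injective ((hT.val_eq _ h0).symm.trans hv)⟩
    · rintro ⟨h0, f, hf⟩
      obtain ⟨v, rfl⟩ := exists_val_of f
      exact ⟨v, by rw [hT.val_eq _ h0, hf]⟩
  rw [key, CosetCert, h]
  simp only [hT.isOne_iff, HomPair.val_fstWord, HomPair.val_sndWord]
  tauto

/-- A solution `x` in the coset of `t` makes the coset certificate yield an `x'` there in both
kernels. Then `x'⁻¹x` comes from an element of `Eq(g', h') ≤ ker g'`, whence `g(x) = g(x') = 1`. -/
theorem Locates.pcpTrivial_of_posCert (hT : T.Locates γ ι) (hV : V.FPMem T.2.1.Grp)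
    (h₁ : ComputesEqualiser V f₁) (h₂ : DecidesProduct V f₂) (h : T.PosCert L f₁ f₂) :
    L.PCPTrivial γ := by
  obtain ⟨U, R, S, hU, hR, hS, hS₁, hC⟩ := h
  have hf := hT.fstHom_restrictPair (fun u hu => (hU u hu).1)
  have hs := hT.sndHom_restrictPair (fun u hu => (hU u hu).2)
  set L' := T.restrictPair L U
  obtain ⟨S', hS', he⟩ := h₁ (T.2.1, L') hV
  obtain rfl := Part.mem_unique hS hS'
  have hker : L'.equaliser T.2.1.gen ≤ (L'.fstHom T.2.1.gen).ker := by
    refine he.le.trans (sup_le ?_ (GroupVariety.lawSubgroup_le_ker hV.1 _))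
    refine (Subgroup.closure_le _).2 ?_
    rintro _ ⟨s, hs, rfl⟩
    refine hT.injective ?_
    rw [hf, map_one, ← HomPair.val_fstWord]
    exact (hT.isOne_iff _).1 (hS₁ s hs)
  rw [HomPair.pcpTrivial_iff]
  intro x hx
  obtain ⟨w, rfl⟩ := exists_val_of x
  obtain ⟨t, ht, v, e⟩ := hR.exists_eq w
  rw [e] at hx ⊢
  obtain ⟨v', hv₁, hv₂⟩ := (hT.cosetCert_iff hV h₂ hU t).1 (hC t ht) ⟨v, hx⟩
  rw [val_append, map_mul, ← hf] at hx hv₁ ⊢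
  rw [map_mul, ← hs] at hx
  rw [val_append, map_mul, ← hs] at hv₂
  have hmem : (v'.val FreeGroup.of)⁻¹ * v.val FreeGroup.of ∈ L'.equaliser T.2.1.gen := by
    change L'.fstHom _ _ = L'.sndHom _ _
    refine hT.injective ?_
    simp only [map_mul, map_inv]
    -- Both sides are multiplied by `g(x') = 1`, which on the right is rewritten as `h(x')`.
    rw [← mul_right_inj (L.fstHom γ (t.val FreeGroup.of) *
      ι (L'.fstHom T.2.1.gen (v'.val FreeGroup.of)))]
    nth_rw 2 [hv₁]
    nth_rw 1 [← hv₂]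
    simpa [mul_assoc] using hx
  have h1 := MonoidHom.mem_ker.1 (hker hmem)
  rw [map_mul, map_inv, inv_mul_eq_one] at h1
  rw [← h1, hv₁]

theorem Locates.posCert_of_pcpTrivial (hT : T.Locates γ ι) (hV : V.FPMem T.2.1.Grp)
    (h₁ : ComputesEqualiser V f₁) (h₂ : DecidesProduct V f₂) (h : L.PCPTrivial γ) :
    T.PosCert L f₁ f₂ := by
  rw [HomPair.pcpTrivial_iff] at h
  let F : Subgroup (FreeGroup (Fin L.length)) :=
    ι.range.comap (L.fstHom γ) ⊓ ι.range.comap (L.sndHom γ)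
  have := hT.finiteIndex
  have hcomap : ∀ g : FreeGroup (Fin L.length) →* Γ, (ι.range.comap g).FiniteIndex := fun g =>
    ⟨by rw [Subgroup.index_comap]; exact Subgroup.FiniteIndex.index_ne_zero⟩
  have := hcomap (L.fstHom γ)
  have := hcomap (L.sndHom γ)
  have hF : F.FiniteIndex := inferInstance
  -- Finite generation of `F` is Schreier's theorem on finite index subgroups, found by instance
  -- search.
  obtain ⟨U, hU⟩ := Subgroup.exists_wordSubgroup_eq F
  have hU' : ∀ u ∈ U, T.pos (L.fstWord u) = 0 ∧ T.pos (L.sndWord u) = 0 := by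
    intro u hu
    have : u.val FreeGroup.of ∈ F := hU ▸ Subgroup.subset_closure ⟨u, hu, rfl⟩
    rw [← hT.mem_iff, ← hT.mem_iff, HomPair.val_fstWord, HomPair.val_sndWord]
    exact this
  have hf := hT.fstHom_restrictPair (fun u hu => (hU' u hu).1)
  have hs := hT.sndHom_restrictPair (fun u hu => (hU' u hu).2)
  obtain ⟨S, hS, he⟩ := h₁ (T.2.1, T.restrictPair L U) hV
  choose f hf' using fun x : FreeGroup (Fin L.length) => exists_val_of x
  have := Fintype.ofFinite (FreeGroup (Fin L.length) ⧸ F)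
  -- The empty word starts the induction in `CoverCert.exists_eq`; representing its coset twice does
  -- no harm.
  let R : List GWord := [] :: (Finset.univ : Finset (FreeGroup (Fin L.length) ⧸ F)).toList.map
    fun q => f q.out
  have hR : CoverCert L.length U R := by
    refine ⟨by simp [R], fun t _ l _ => ?_⟩
    let q : FreeGroup (Fin L.length) ⧸ F := QuotientGroup.mk (GWord.val FreeGroup.of (l :: t))
    refine ⟨f q.out, by simp [R], ?_⟩
    have hq : (q.out)⁻¹ * GWord.val FreeGroup.of (l :: t) ∈ F :=
      QuotientGroup.eq.1 (QuotientGroup.out_eq'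
        (QuotientGroup.mk (GWord.val FreeGroup.of (l :: t)) : FreeGroup (Fin L.length) ⧸ F))
    have hq := (mem_wordSubgroup_iff _).1 (hU.ge hq)
    obtain ⟨v, hv⟩ := hq
    refine ⟨v, ?_⟩
    rw [FinPres.val_gen_free_eq_one_iff, val_append, val_invRev, mul_inv_eq_one, val_append, hv,
      hf', mul_inv_cancel_left]
  refine ⟨U, R, S, hU', hR, hS, fun s hsS => ?_, fun t _ => ?_⟩
  · have : GWord.val FreeGroup.of s ∈ (T.restrictPair L U).equaliser T.2.1.gen :=
      he ▸ Subgroup.mem_sup_left (Subgroup.subset_closure ⟨s, hsS, rfl⟩)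
    have this' : (T.restrictPair L U).fstHom _ _ = (T.restrictPair L U).sndHom _ _ := this
    rw [hT.isOne_iff, HomPair.val_fstWord]
    refine h _ ?_
    rw [← hf, ← hs, this']
  · rw [hT.cosetCert_iff hV h₂ hU']
    rintro ⟨v, hv⟩
    exact ⟨v, h _ hv, hv ▸ h _ hv⟩

end

end CosetTable

/-! ### Semidecidability of the certificates for and against triviality. -/

namespace CosetTable

section

variable {α : Type} [Primcodable α] {T : α → CosetTable} {L : α → HomPair} {w : α → GWord}

theorem sigmaOne_isOne_comp (hT : Primrec T) (hw : Primrec w) :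
    SigmaOne fun a => (T a).IsOne (w a) :=
  sigmaOne_isOne.comp (f := fun a => (T a, w a)) (hT.pair hw)

theorem sigmaOne_pos_eq (hT : Primrec T) (hw : Primrec w) :
    SigmaOne fun a => (T a).pos (w a) = 0 :=
  SigmaOne.of_primrec (Primrec.eq.comp (pos_prim.comp hT hw) (Primrec.const 0))

theorem sigmaOne_pos_ne (hT : Primrec T) (hw : Primrec w) :
    SigmaOne fun a => (T a).pos (w a) ≠ 0 :=
  SigmaOne.of_primrec (Primrec.eq.comp (pos_prim.comp hT hw) (Primrec.const 0)).not

theorem sigmaOne_false_mem {β : Type} [Primcodable β] {f : β →. Bool} (hf : Partrec f)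
    {g : α → β} (hg : Primrec g) : SigmaOne fun a => false ∈ f (g a) :=
  (SigmaOne.graph hf).comp (f := fun a => (g a, false)) (hg.pair (Primrec.const false))

variable {f₂ : FinPres × List GWord × List GWord × GWord →. Bool}

theorem sigmaOne_isNotOne (hf₂ : Partrec f₂) (hT : Primrec T) (hw : Primrec w) :
    SigmaOne fun a => (T a).IsNotOne f₂ (w a) :=
  (sigmaOne_pos_ne hT hw).or (sigmaOne_false_mem hf₂ ((Primrec.fst.comp (Primrec.snd.comp hT)).pair
    ((Primrec.const []).pair ((Primrec.const []).pair (rewrite_prim.comp hT hw)))))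

theorem sigmaOne_negCert (hf₂ : Partrec f₂) :
    SigmaOne fun x : CosetTable × HomPair => x.1.NegCert x.2 f₂ := by
  have hT : Primrec fun x : (CosetTable × HomPair) × GWord => x.1.1 :=
    Primrec.fst.comp Primrec.fst
  have hL : Primrec fun x : (CosetTable × HomPair) × GWord => x.1.2 :=
    Primrec.snd.comp Primrec.fst
  have hg := HomPair.fstWord_prim.comp hL Primrec.snd
  have hh := HomPair.sndWord_prim.comp hL Primrec.snd
  have h := (sigmaOne_isOne_comp hT (Primrec.list_append.comp hg (invRev_prim.comp hh))).and
    (sigmaOne_isNotOne hf₂ hT hg)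
  exact SigmaOne.ex h

end

theorem restrictPair_prim :
    Primrec fun x : CosetTable × HomPair × List GWord => x.1.restrictPair x.2.1 x.2.2 := by
  have hT : Primrec fun x : (CosetTable × HomPair × List GWord) × GWord => x.1.1 :=
    Primrec.fst.comp Primrec.fst
  have hL : Primrec fun x : (CosetTable × HomPair × List GWord) × GWord => x.1.2.1 :=
    Primrec.fst.comp (Primrec.snd.comp Primrec.fst)
  have h := (rewrite_prim.comp hT (HomPair.fstWord_prim.comp hL Primrec.snd)).pair
    (rewrite_prim.comp hT (HomPair.sndWord_prim.comp hL Primrec.snd))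
  exact Primrec.list_map (Primrec.snd.comp Primrec.snd) h.to₂

theorem productQuery_prim :
    Primrec fun x : FinPres × HomPair × GWord => productQuery x.1 x.2.1 x.2.2 := by
  have hA : Primrec fun p : GWord × GWord => evens p.1 ++ odds p.2 :=
    Primrec.list_append.comp (evens_prim.comp Primrec.fst) (odds_prim.comp Primrec.snd)
  have hB : Primrec fun j : ℕ => [(2 * j, true), (2 * j + 1, true)] :=
    Primrec.list_cons.comp (Primrec.nat_double.pair (Primrec.const true))
      (Primrec.list_cons.comp (Primrec.nat_double_succ.pair (Primrec.const true))
        (Primrec.const []))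
  have hA' : Primrec fun x : FinPres × HomPair × GWord =>
      x.2.1.map fun p => evens p.1 ++ odds p.2 :=
    Primrec.list_map (Primrec.fst.comp Primrec.snd) (hA.comp Primrec.snd).to₂
  have hB' : Primrec fun x : FinPres × HomPair × GWord =>
      (List.range x.1.1).map fun j => [(2 * j, true), (2 * j + 1, true)] :=
    Primrec.list_map (Primrec.list_range.comp (Primrec.fst.comp Primrec.fst))
      (hB.comp Primrec.snd).to₂
  have := (FinPres.sq_prim.comp Primrec.fst).pair (hA'.pair (hB'.pair
    (odds_prim.comp (Primrec.snd.comp (Primrec.snd (α := FinPres) (β := HomPair × GWord))))))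
  exact this

theorem quotWord_prim : Primrec₂ quotWord := by
  have := Primrec.list_append.comp (invRev_prim.comp HomPair.sndWord_prim) HomPair.fstWord_prim
  exact this

theorem sigmaOne_cosetCert {f₂ : FinPres × List GWord × List GWord × GWord →. Bool}
    (hf₂ : Partrec f₂) : SigmaOne fun x : CosetTable × HomPair × List GWord × GWord =>
      x.1.CosetCert x.2.1 f₂ x.2.2.1 x.2.2.2 := by
  have hT : Primrec fun x : CosetTable × HomPair × List GWord × GWord => x.1 := Primrec.fst
  have hL : Primrec fun x : CosetTable × HomPair × List GWord × GWord => x.2.1 :=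
    Primrec.fst.comp Primrec.snd
  have hU : Primrec fun x : CosetTable × HomPair × List GWord × GWord => x.2.2.1 :=
    Primrec.fst.comp (Primrec.snd.comp Primrec.snd)
  have ht : Primrec fun x : CosetTable × HomPair × List GWord × GWord => x.2.2.2 :=
    Primrec.snd.comp (Primrec.snd.comp Primrec.snd)
  have hq := quotWord_prim.comp hL ht
  have hr : Primrec fun x : CosetTable × HomPair × List GWord × GWord =>
      x.1.restrictPair x.2.1 x.2.2.1 :=
    restrictPair_prim.comp (g := fun x : CosetTable × HomPair × List GWord × GWord =>
      (x.1, x.2.1, x.2.2.1)) (hT.pair (hL.pair hU))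
  have hQ : Primrec fun x : CosetTable × HomPair × List GWord × GWord =>
      productQuery x.1.2.1 (x.1.restrictPair x.2.1 x.2.2.1)
        (x.1.rewrite (quotWord x.2.1 x.2.2.2)) :=
    productQuery_prim.comp (g := fun x : CosetTable × HomPair × List GWord × GWord =>
      (x.1.2.1, x.1.restrictPair x.2.1 x.2.2.1, x.1.rewrite (quotWord x.2.1 x.2.2.2)))
      ((Primrec.fst.comp (Primrec.snd.comp hT)).pair (hr.pair (rewrite_prim.comp hT hq)))
  have hw := Primrec.list_append.comp
    (ht.comp (Primrec.fst (α := CosetTable × HomPair × List GWord × GWord) (β := GWord)))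
    (subst_prim.comp (hU.comp Primrec.fst) Primrec.snd)
  have h₁ := sigmaOne_isOne_comp (hT.comp Primrec.fst)
    (HomPair.fstWord_prim.comp (hL.comp Primrec.fst) hw)
  have h₂ := sigmaOne_isOne_comp (hT.comp Primrec.fst)
    (HomPair.sndWord_prim.comp (hL.comp Primrec.fst) hw)
  have h₃ := SigmaOne.ex (p := fun (x : CosetTable × HomPair × List GWord × GWord) (v : GWord) =>
    x.1.IsOne (x.2.1.fstWord (x.2.2.2 ++ subst x.2.2.1 v)) ∧
      x.1.IsOne (x.2.1.sndWord (x.2.2.2 ++ subst x.2.2.1 v))) (h₁.and h₂)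
  exact (sigmaOne_pos_ne hT hq).or ((sigmaOne_false_mem hf₂ hQ).or h₃)

theorem sigmaOne_coverCert :
    SigmaOne fun x : ℕ × List GWord × List GWord => CoverCert x.1 x.2.1 x.2.2 := by
  let β := ℕ × List GWord × List GWord
  have hk : Primrec fun x : β => x.1 := Primrec.fst
  have hU : Primrec fun x : β => x.2.1 := Primrec.fst.comp Primrec.snd
  have hR : Primrec fun x : β => x.2.2 := Primrec.snd.comp Primrec.snd
  have p₁ : Primrec fun y : (((β × GWord) × (ℕ × Bool)) × GWord) × GWord => y.1.1.1.1 :=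
    Primrec.fst.comp (Primrec.fst.comp (Primrec.fst.comp Primrec.fst))
  have p₂ : Primrec fun y : (((β × GWord) × (ℕ × Bool)) × GWord) × GWord => y.1.1.1.2 :=
    Primrec.snd.comp (Primrec.fst.comp (Primrec.fst.comp Primrec.fst))
  have p₃ : Primrec fun y : (((β × GWord) × (ℕ × Bool)) × GWord) × GWord => y.1.1.2 :=
    Primrec.snd.comp (Primrec.fst.comp Primrec.fst)
  have p₄ : Primrec fun y : (((β × GWord) × (ℕ × Bool)) × GWord) × GWord => y.1.2 :=
    Primrec.snd.comp Primrec.fst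
  have hw := Primrec.list_append.comp (Primrec.list_cons.comp p₃ p₂)
    (invRev_prim.comp (Primrec.list_append.comp p₄ (subst_prim.comp (hU.comp p₁) Primrec.snd)))
  have h₁ : SigmaOne fun y : (((β × GWord) × (ℕ × Bool)) × GWord) × GWord =>
      GWord.val (FinPres.gen (y.1.1.1.1.1, []))
        (y.1.1.2 :: y.1.1.1.2 ++ FreeGroup.invRev (y.1.2 ++ subst y.1.1.1.1.2.1 y.2)) = 1 :=
    FinPres.sigmaOne_val_gen_eq_one.comp
      (f := fun y : (((β × GWord) × (ℕ × Bool)) × GWord) × GWord => ((y.1.1.1.1.1, []),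
        y.1.1.2 :: y.1.1.1.2 ++ FreeGroup.invRev (y.1.2 ++ subst y.1.1.1.1.2.1 y.2)))
      (((hk.comp p₁).pair (Primrec.const [])).pair hw)
  have h₂ := SigmaOne.exists_mem (p := fun (y : (β × GWord) × (ℕ × Bool)) (t' : GWord) =>
      ∃ v, GWord.val (FinPres.gen (y.1.1.1, []))
        (y.2 :: y.1.2 ++ FreeGroup.invRev (t' ++ subst y.1.1.2.1 v)) = 1)
    (SigmaOne.ex h₁) (f := fun y => y.1.1.2.2) (hR.comp (Primrec.fst.comp Primrec.fst))
  have h₃ := SigmaOne.forall_mem (p := fun (y : β × GWord) (l : ℕ × Bool) =>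
      ∃ t' ∈ y.1.2.2, ∃ v, GWord.val (FinPres.gen (y.1.1, []))
        (l :: y.2 ++ FreeGroup.invRev (t' ++ subst y.1.2.1 v)) = 1) h₂
    (f := fun y => letters y.1.1) (letters_prim.comp (hk.comp Primrec.fst))
  have h₄ := SigmaOne.forall_mem (p := fun (y : β) (t : GWord) =>
      ∀ l ∈ letters y.1, ∃ t' ∈ y.2.2, ∃ v, GWord.val (FinPres.gen (y.1, []))
        (l :: t ++ FreeGroup.invRev (t' ++ subst y.2.1 v)) = 1) h₃ hR
  exact (SigmaOne.of_primrec (SigmaOne.mem_list.comp ((Primrec.const []).pair hR))).and h₄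

theorem sigmaOne_posCert {f₁ : FinPres × HomPair →. List GWord} (hf₁ : Partrec f₁)
    {f₂ : FinPres × List GWord × List GWord × GWord →. Bool} (hf₂ : Partrec f₂) :
    SigmaOne fun x : CosetTable × HomPair => x.1.PosCert x.2 f₁ f₂ := by
  let β := (((CosetTable × HomPair) × List GWord) × List GWord) × List GWord
  have hT : Primrec fun x : β => x.1.1.1.1 :=
    Primrec.fst.comp (Primrec.fst.comp (Primrec.fst.comp Primrec.fst))
  have hL : Primrec fun x : β => x.1.1.1.2 :=
    Primrec.snd.comp (Primrec.fst.comp (Primrec.fst.comp Primrec.fst))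
  have hU : Primrec fun x : β => x.1.1.2 := Primrec.snd.comp (Primrec.fst.comp Primrec.fst)
  have hR : Primrec fun x : β => x.1.2 := Primrec.snd.comp Primrec.fst
  have hS : Primrec fun x : β => x.2 := Primrec.snd
  have h₁ := SigmaOne.forall_mem (p := fun (x : β) (u : GWord) =>
      x.1.1.1.1.pos (x.1.1.1.2.fstWord u) = 0 ∧ x.1.1.1.1.pos (x.1.1.1.2.sndWord u) = 0)
    ((sigmaOne_pos_eq (hT.comp Primrec.fst)
        (HomPair.fstWord_prim.comp (hL.comp Primrec.fst) Primrec.snd)).and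
      (sigmaOne_pos_eq (hT.comp Primrec.fst)
        (HomPair.sndWord_prim.comp (hL.comp Primrec.fst) Primrec.snd))) hU
  have h₂ := sigmaOne_coverCert.comp (f := fun x : β => (x.1.1.1.2.length, x.1.1.2, x.1.2))
    ((Primrec.list_length.comp hL).pair (hU.pair hR))
  have hr : Primrec fun x : β => x.1.1.1.1.restrictPair x.1.1.1.2 x.1.1.2 :=
    restrictPair_prim.comp (g := fun x : β => (x.1.1.1.1, x.1.1.1.2, x.1.1.2))
      (hT.pair (hL.pair hU))
  have h₃ := (SigmaOne.graph hf₁).comp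
    (f := fun x : β => ((x.1.1.1.1.2.1, x.1.1.1.1.restrictPair x.1.1.1.2 x.1.1.2), x.2))
    (((Primrec.fst.comp (Primrec.snd.comp hT)).pair hr).pair hS)
  have h₄ := SigmaOne.forall_mem (p := fun (x : β) (s : GWord) =>
      x.1.1.1.1.IsOne (x.1.1.1.2.fstWord (subst x.1.1.2 s)))
    (sigmaOne_isOne_comp (hT.comp Primrec.fst) (HomPair.fstWord_prim.comp (hL.comp Primrec.fst)
      (subst_prim.comp (hU.comp Primrec.fst) Primrec.snd))) hS
  have h₅ := SigmaOne.forall_mem (p := fun (x : β) (t : GWord) =>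
      x.1.1.1.1.CosetCert x.1.1.1.2 f₂ x.1.1.2 t)
    ((sigmaOne_cosetCert hf₂).comp
      (f := fun x : β × GWord => (x.1.1.1.1.1, x.1.1.1.1.2, x.1.1.1.2, x.2))
      ((hT.comp Primrec.fst).pair ((hL.comp Primrec.fst).pair
        ((hU.comp Primrec.fst).pair Primrec.snd)))) hR
  have h := h₁.and (h₂.and (h₃.and (h₄.and h₅)))
  exact SigmaOne.ex (SigmaOne.ex (SigmaOne.ex h))

end CosetTable

/-! ## Existence and verification of coset tables -/

namespace CosetTable

/-- The table `T` describes the left multiplication by the elements `γ` on the `r` cosets of the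
image of the embedding `ι`, with respect to the coset representatives `c`. -/
structure IsCosetTable (T : CosetTable) (r : ℕ) {n : ℕ} {Γ : Type} [Group Γ] (γ : Fin n → Γ)
    (ι : T.2.1.Grp →* Γ) (c : ℕ → Γ) : Prop where
  rank : T.1 = n
  injective : Function.Injective ι
  pos : 0 < r
  one : c 0 = 1
  sep : ∀ i < r, ∀ j < r, (c i)⁻¹ * c j ∈ ι.range → i = j
  lt : ∀ l : ℕ × Bool, l.1 < n → ∀ i < r, (T.look l i).1 < r
  step : ∀ l : ℕ × Bool, l.1 < n → ∀ i < r,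
    GWord.val γ [l] * c i = c (T.look l i).1 * ι ((T.look l i).2.val T.2.1.gen)

variable {T : CosetTable} {r n : ℕ} {Γ : Type} [Group Γ] {γ : Fin n → Γ} {ι : T.2.1.Grp →* Γ}
  {c : ℕ → Γ}

theorem look_of_le {l : ℕ × Bool} (h : T.1 ≤ l.1) (i : ℕ) : T.look l i = (i, []) := by
  simp [look, Nat.not_lt.2 h]

theorem IsCosetTable.run_spec (h : T.IsCosetTable r γ ι c) (w : GWord) {i : ℕ} (hi : i < r) :
    (T.run w i).1 < r ∧
      w.val γ * c i = c (T.run w i).1 * ι ((T.run w i).2.val T.2.1.gen) := by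
  induction w with
  | nil => simp [hi]
  | cons l w ih =>
    rw [run_cons, val_cons, mul_assoc, ih.2, ← mul_assoc]
    by_cases hl : l.1 < n
    · refine ⟨h.lt l hl _ ih.1, ?_⟩
      rw [h.step l hl _ ih.1, val_append, map_mul, mul_assoc]
    · rw [look_of_le (h.rank.trans_le (not_lt.1 hl)), val_letter_of_le _ (not_lt.1 hl)]
      exact ⟨ih.1, by simp⟩

/-- Running a word from the representative `c 0 = 1` writes its value as `c j * ι u`; by `sep` this
lies in the subgroup exactly when `j = 0`. -/
theorem IsCosetTable.locates (h : T.IsCosetTable r γ ι c) (hf : ι.range.FiniteIndex) :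
    T.Locates γ ι := by
  have hs : ∀ w : GWord, w.val γ = c (T.pos w) * ι ((T.rewrite w).val T.2.1.gen) := fun w => by
    have := (h.run_spec w h.pos).2
    rwa [h.one, mul_one] at this
  refine ⟨h.injective, hf, fun w => ?_, fun w hw => ?_⟩
  · constructor
    · intro hw
      refine (h.sep 0 h.pos _ (h.run_spec w h.pos).1 ?_).symm
      rw [h.one, inv_one, one_mul]
      rw [hs] at hw
      exact (Subgroup.mul_mem_cancel_right ι.range (MonoidHom.mem_range.2 ⟨_, rfl⟩)).1 hw
    · intro hw
      rw [hs, hw, h.one, one_mul]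
      exact ⟨_, rfl⟩
  · rw [hs, hw, h.one, one_mul]

end CosetTable

/-! ### Existence of coset tables for finite index subgroups. -/

theorem List.exists_getD_encode {α β : Type} [Encodable α] (s : List α) (f : α → β) (d : β) :
    ∃ L : List β, ∀ a ∈ s, L.getD (Encodable.encode a) d = f a := by
  refine ⟨(List.range ((s.map Encodable.encode).sum + 1)).map fun m =>
    ((Encodable.decode m).map f).getD d, fun a ha => ?_⟩
  have : Encodable.encode a < (s.map Encodable.encode).sum + 1 :=
    Nat.lt_succ_of_le (List.single_le_sum (by simp) _ (List.mem_map_of_mem ha))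
  rw [List.getD_eq_getElem _ _ (by simpa using this)]
  simp

theorem Subgroup.exists_transversal {Γ : Type} [Group Γ] (K : Subgroup Γ) [K.FiniteIndex] :
    ∃ (r : ℕ) (c : ℕ → Γ), 0 < r ∧ c 0 = 1 ∧
      (∀ i < r, ∀ j < r, (c i)⁻¹ * c j ∈ K → i = j) ∧ ∀ x, ∃ i < r, (c i)⁻¹ * x ∈ K := by
  let σ := (Finite.equivFin (Γ ⧸ K)).symm
  have hr : 0 < Nat.card (Γ ⧸ K) := Nat.card_pos
  -- The swap gives the trivial coset the index `0`, so that its representative can be chosen to be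
  -- `1` itself.
  let τ : Fin (Nat.card (Γ ⧸ K)) ≃ Γ ⧸ K := (Equiv.swap ⟨0, hr⟩ (σ.symm (1 : Γ))).trans σ
  have hτ : τ ⟨0, hr⟩ = (1 : Γ) := by simp [τ]
  have hc : ∀ i : ℕ, ∃ x : Γ, (i = 0 → x = 1) ∧ ∀ h : i < Nat.card (Γ ⧸ K), x = τ ⟨i, h⟩ := by
    intro i
    rcases Nat.eq_zero_or_pos i with rfl | hi
    · exact ⟨1, fun _ => rfl, fun _ => hτ.symm⟩
    · by_cases h : i < Nat.card (Γ ⧸ K)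
      · exact ⟨(τ ⟨i, h⟩).out, fun h => absurd h hi.ne', fun _ => QuotientGroup.out_eq' _⟩
      · exact ⟨1, fun _ => rfl, fun h' => absurd h' h⟩
  choose c hc₀ hc using hc
  refine ⟨_, c, hr, hc₀ 0 rfl, fun i hi j hj h => ?_, fun x => ?_⟩
  · have := QuotientGroup.eq.2 h
    rw [hc i hi, hc j hj] at this
    exact congrArg Fin.val (τ.injective this)
  · refine ⟨τ.symm x, Fin.isLt _, QuotientGroup.eq.1 ?_⟩
    rw [hc _ (Fin.isLt _)]
    simp

theorem FinPres.exists_mulEquiv (G : Type) [Group G] [Group.IsFinitelyPresented G] :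
    ∃ P : FinPres, Nonempty (P.Grp ≃* G) := by
  obtain ⟨n, s, hs, ⟨e⟩⟩ := Group.IsFinitelyPresented.exists_mulEquiv_presentedGroup (G := G)
  choose f hf using fun x : FreeGroup (Fin n) => exists_val_of x
  obtain ⟨S, rfl⟩ : ∃ S, FinPres.rels (n, S) = s := by
    refine ⟨hs.toFinset.toList.map f, ?_⟩
    ext x
    simp [FinPres.rels, hf]
  exact ⟨(n, S), ⟨e.symm⟩⟩

namespace CosetTable

theorem exists_isCosetTable {n : ℕ} {Γ : Type} [Group Γ] (γ : Fin n → Γ) {P : FinPres}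
    {ι : P.Grp →* Γ} (hι : Function.Injective ι) (hK : ι.range.FiniteIndex) :
    ∃ tab r c, IsCosetTable (n, P, tab) r γ ι c := by
  obtain ⟨r, c, hr, h0, hsep, hcov⟩ := ι.range.exists_transversal
  have hentry : ∀ x : (ℕ × Bool) × ℕ, ∃ y : ℕ × GWord, y.1 < r ∧
      GWord.val γ [x.1] * c x.2 = c y.1 * ι (y.2.val P.gen) := by
    intro x
    obtain ⟨j, hj, a, ha⟩ := hcov (GWord.val γ [x.1] * c x.2)
    obtain ⟨u, rfl⟩ := P.exists_val_gen a
    exact ⟨(j, u), hj, by rw [ha, mul_inv_cancel_left]⟩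
  choose entry hlt hstep using hentry
  obtain ⟨tab, htab⟩ := List.exists_getD_encode ((letters n) ×ˢ (List.range r)) entry (0, [])
  have hlook : ∀ l : ℕ × Bool, l.1 < n → ∀ i < r, look (n, P, tab) l i = entry (l, i) := by
    intro l hl i hi
    rw [look, if_pos hl, htab (l, i) (by simp [mem_letters, hl, hi])]
  refine ⟨tab, r, c, rfl, hι, hr, h0, hsep, fun l hl i hi => ?_, fun l hl i hi => ?_⟩
  · rw [hlook l hl i hi]
    exact hlt _
  · rw [hlook l hl i hi]
    exact hstep (l, i)

/-! ### Certificates of correctness for coset tables. -/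

/-- The data showing that `T` is a coset table of the subgroup generated by `S` in the group
presented by `Q`: the words `p` are the generators of the subgroup, the words `c` are coset
representatives, and the action given by the table respects the relators. -/
structure TableCert (Q : FinPres) (S : List GWord) (T : CosetTable) (r : ℕ) (p c : List GWord) :
    Prop where
  rank : T.1 = Q.1
  pos : 0 < r
  one : c.getD 0 [] = []
  length : p.length = T.2.1.1
  rels : ∀ w ∈ T.2.1.2, (subst p w).val Q.gen = 1
  le : ∀ w ∈ p, ∃ v, (w ++ FreeGroup.invRev (subst S v)).val Q.gen = 1
  ge : ∀ w ∈ S, ∃ v, (w ++ FreeGroup.invRev (subst p v)).val Q.gen = 1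
  step : ∀ l ∈ letters Q.1, ∀ i ∈ List.range r, (T.look l i).1 < r ∧
    GWord.val Q.gen (l :: c.getD i [] ++ FreeGroup.invRev
      (c.getD (T.look l i).1 [] ++ subst p (T.look l i).2)) = 1
  -- Relators and products of a letter with its inverse must fix every coset with trivial subgroup
  -- value; this is what makes the table an action of the presented group.
  act : ∀ w ∈ Q.2 ++ (letters Q.1).map fun l => [l, (l.1, !l.2)], ∀ i ∈ List.range r,
    (T.run w i).1 = i ∧ (T.run w i).2.val T.2.1.gen = 1
  base : ∀ i ∈ List.range r,
    T.pos (c.getD i []) = i ∧ (T.rewrite (c.getD i [])).val T.2.1.gen = 1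
  gen : ∀ j ∈ List.range T.2.1.1, T.pos (p.getD j []) = 0 ∧
    (T.rewrite (p.getD j []) ++ [(j, false)]).val T.2.1.gen = 1

/-- Injectivity of `ι` and distinctness of the cosets are not equations in `Q.Grp`; they are read
off from an action. By `act` the table lets `Q.Grp` act on `X`, which is `r` copies of the group
presented by `T.2.1`. By `gen`, `ι a` sends `(0, b)` to `(0, a * b)`, so `ι a = 1` forces `a = 1`.
By `base`, the representative `c i` sends `(0, a)` to `(i, a)`, so `c j = c i * ι a` forces `i = j`.
-/
theorem TableCert.exists_isCosetTable {Q : FinPres} {S : List GWord} {T : CosetTable} {r : ℕ}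
    {p c : List GWord} (h : TableCert Q S T r p c) :
    ∃ ι : T.2.1.Grp →* Q.Grp, T.IsCosetTable r Q.gen ι (fun i => (c.getD i []).val Q.gen) ∧
      ι.range = wordSubgroup Q.gen S := by
  have hp : ∀ v : GWord, (subst p v).val Q.gen = v.val fun j : Fin T.2.1.1 =>
      (p.getD j []).val Q.gen :=
    val_subst_of _ h.length.le fun _ => rfl
  let ι : T.2.1.Grp →* Q.Grp := T.2.1.hom (fun j => (p.getD j []).val Q.gen) fun w hw => by
    rw [← hp, h.rels w hw]
  have hι : ∀ v : GWord, ι (v.val T.2.1.gen) = (subst p v).val Q.gen := fun v => by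
    rw [hp, FinPres.hom_val]
  have hlt : ∀ l i, i < r → (T.look l i).1 < r := by
    intro l i hi
    by_cases hl : l.1 < Q.1
    · exact (h.step l (mem_letters.2 hl) i (List.mem_range.2 hi)).1
    · rwa [look_of_le (h.rank.trans_le (not_lt.1 hl))]
  have hlt' : ∀ w i, i < r → (T.run w i).1 < r := by
    intro w i hi
    induction w with
    | nil => exact hi
    | cons l w ih => exact hlt l _ ih
  let X := {i // i < r} × T.2.1.Grp
  let f (l : ℕ × Bool) (x : X) : X :=
    (⟨(T.look l x.1).1, hlt _ _ x.1.2⟩, (T.look l x.1).2.val T.2.1.gen * x.2)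
  have hff : ∀ l : ℕ × Bool, l.1 < Q.1 → ∀ x, f l (f (l.1, !l.2) x) = x := by
    rintro l hl ⟨⟨i, hi⟩, a⟩
    have := h.act [l, (l.1, !l.2)] (List.mem_append_right _ (List.mem_map.2
      ⟨l, mem_letters.2 hl, rfl⟩)) i (List.mem_range.2 hi)
    simp only [run_cons, run_nil, List.append_nil, val_append] at this
    refine Prod.ext (Subtype.ext this.1) ?_
    simp only [f]
    rw [← mul_assoc, this.2, one_mul]
  let δ : Fin Q.1 → Equiv.Perm X := fun x =>
    ⟨f (x, true), f (x, false), hff (x, false) x.2, hff (x, true) x.2⟩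
  have hδ : ∀ (w : GWord) (x : X), w.val δ x =
      (⟨(T.run w x.1).1, hlt' _ _ x.1.2⟩, (T.run w x.1).2.val T.2.1.gen * x.2) := by
    intro w x
    induction w with
    | nil => simp
    | cons l w ih =>
      rw [val_cons, Equiv.Perm.mul_apply, ih]
      obtain ⟨i, b⟩ := l
      by_cases hi : i < Q.1
      · have : GWord.val δ [(i, b)] = f (i, b) := by
          cases b
          · exact congrArg _ (val_letter_inv δ ⟨i, hi⟩)
          · exact congrArg _ (val_letter δ ⟨i, hi⟩)
        rw [this]
        refine Prod.ext rfl ?_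
        simp [f, run_cons, mul_assoc]
      · rw [val_letter_of_le _ (not_lt.1 hi)]
        have hl := T.look_of_le (l := (i, b)) (h.rank.trans_le (not_lt.1 hi)) (T.run w x.1).1
        refine Prod.ext (Subtype.ext ?_) ?_ <;> simp [run_cons, hl]
  let ρ : Q.Grp →* Equiv.Perm X := Q.hom δ fun w hw => by
    refine Equiv.ext fun x => ?_
    have := h.act w (List.mem_append_left _ hw) x.1 (List.mem_range.2 x.1.2)
    rw [hδ]
    refine Prod.ext (Subtype.ext this.1) ?_
    simp [this.2]
  have hρ : ∀ (w : GWord) (x : X), ρ (w.val Q.gen) x =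
      (⟨(T.run w x.1).1, hlt' _ _ x.1.2⟩, (T.run w x.1).2.val T.2.1.gen * x.2) := fun w x => by
    rw [← hδ, FinPres.hom_val]
  have hρι : ∀ a b, ρ (ι a) (⟨0, h.pos⟩, b) = (⟨0, h.pos⟩, a * b) := by
    intro a
    have ha : a ∈ Subgroup.closure (Set.range T.2.1.gen) :=
      T.2.1.closure_range_gen ▸ Subgroup.mem_top a
    induction ha using Subgroup.closure_induction with
    | mem x hx =>
      obtain ⟨j, rfl⟩ := hx
      intro b
      have hj := h.gen j (List.mem_range.2 j.2)
      rw [val_append, val_letter_inv, mul_inv_eq_one] at hj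
      have : ι (T.2.1.gen j) = (p.getD j []).val Q.gen := PresentedGroup.toGroup.of _
      rw [this, hρ]
      refine Prod.ext (Subtype.ext hj.1) ?_
      simp only
      rw [← hj.2]
      rfl
    | one => simp
    | mul x y _ _ hx hy =>
      intro b
      rw [map_mul, map_mul, Equiv.Perm.mul_apply, hy, hx, mul_assoc]
    | inv x _ hx =>
      intro b
      rw [map_inv, map_inv, Equiv.Perm.inv_eq_iff_eq, hx, mul_inv_cancel_left]
  have hρc : ∀ (i : ℕ) (hi : i < r) (a : T.2.1.Grp),
      ρ ((c.getD i []).val Q.gen) (⟨0, h.pos⟩, a) = (⟨i, hi⟩, a) := by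
    intro i hi a
    have := h.base i (List.mem_range.2 hi)
    rw [hρ]
    refine Prod.ext (Subtype.ext this.1) ?_
    have h2 := this.2
    rw [rewrite] at h2
    change _ * a = a
    rw [h2, one_mul]
  refine ⟨ι, ⟨h.rank, ?_, h.pos, by simp only [h.one, val_nil], ?_, ?_, ?_⟩, ?_⟩
  · rw [injective_iff_map_eq_one]
    intro a ha
    have := hρι a 1
    rw [ha] at this
    simpa using (congrArg Prod.snd this).symm
  · rintro i hi j hj ⟨a, ha⟩
    rw [eq_inv_mul_iff_mul_eq] at ha
    have := hρc j hj 1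
    rw [← ha, map_mul, Equiv.Perm.mul_apply, hρι, hρc i hi] at this
    exact congrArg (fun x : X => x.1.1) this
  · intro l hl i hi
    exact hlt l i hi
  · intro l hl i hi
    have := (h.step l (mem_letters.2 hl) i (List.mem_range.2 hi)).2
    rw [val_append, val_invRev, mul_inv_eq_one, val_cons, val_append] at this
    rw [this, hι]
  · have hr : ∀ x, x ∈ ι.range ↔ x ∈ wordSubgroup Q.gen p := by
      intro x
      rw [mem_wordSubgroup_iff]
      constructor
      · rintro ⟨a, rfl⟩
        obtain ⟨v, rfl⟩ := T.2.1.exists_val_gen a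
        exact ⟨v, (hι v).symm⟩
      · rintro ⟨v, rfl⟩
        exact ⟨_, hι v⟩
    rw [Subgroup.ext hr]
    apply le_antisymm
    · refine (Subgroup.closure_le _).2 ?_
      rintro _ ⟨w, hw, rfl⟩
      obtain ⟨v, hv⟩ := h.le w hw
      rw [val_append, val_invRev, mul_inv_eq_one] at hv
      exact (mem_wordSubgroup_iff _).2 ⟨v, hv.symm⟩
    · refine (Subgroup.closure_le _).2 ?_
      rintro _ ⟨w, hw, rfl⟩
      obtain ⟨v, hv⟩ := h.ge w hw
      rw [val_append, val_invRev, mul_inv_eq_one] at hv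
      exact (mem_wordSubgroup_iff _).2 ⟨v, hv.symm⟩

theorem IsCosetTable.exists_tableCert {Q : FinPres} {S : List GWord} {T : CosetTable} {r : ℕ}
    {ι : T.2.1.Grp →* Q.Grp} {c : ℕ → Q.Grp} (h : T.IsCosetTable r Q.gen ι c)
    (hS : ι.range = wordSubgroup Q.gen S) : ∃ p c', TableCert Q S T r p c' := by
  choose f hf using Q.exists_val_gen
  let p : List GWord := (List.finRange T.2.1.1).map fun j => f (ι (T.2.1.gen j))
  -- The field `one` asks for the empty word itself at index `0`, not merely for a word of value
  -- `1`.
  let c' : List GWord := (List.range r).map fun i => if i = 0 then [] else f (c i)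
  have hc : ∀ i < r, (c'.getD i []).val Q.gen = c i := by
    intro i hi
    rw [List.getD_eq_getElem _ _ (by simpa [c'] using hi)]
    by_cases h0 : i = 0
    · subst h0
      simp [c', h.one]
    · simp [c', h0, hf]
  have hpj : ∀ j : Fin T.2.1.1, (p.getD j []).val Q.gen = ι (T.2.1.gen j) := by
    intro j
    rw [List.getD_eq_getElem _ _ (by simp [p])]
    simp [p, hf]
  have hp : ∀ v : GWord, (subst p v).val Q.gen = ι (v.val T.2.1.gen) := by
    intro v
    rw [map_val, val_subst_of _ (by simp [p]) hpj]
  -- The decomposition `c j * ι u` of an element is unique, by `sep` and the injectivity of `ι`, so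
  -- the table must find the expected one.
  have hrun : ∀ w i j, i < r → j < r → w.val Q.gen * c i = c j →
      (T.run w i).1 = j ∧ (T.run w i).2.val T.2.1.gen = 1 := by
    intro w i j hi hj e
    obtain ⟨hlt, hrun⟩ := h.run_spec w hi
    rw [e] at hrun
    have hij := h.sep _ hlt j hj ⟨_, (inv_mul_eq_iff_eq_mul.2 hrun).symm⟩
    refine ⟨hij, h.injective ?_⟩
    rw [hij, left_eq_mul] at hrun
    rw [hrun, map_one]
  have hloc : ∀ w a, w.val Q.gen = ι a →
      T.pos w = 0 ∧ (T.rewrite w).val T.2.1.gen = a := by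
    intro w a e
    obtain ⟨hlt, hrun⟩ := h.run_spec w h.pos
    rw [e, h.one, mul_one] at hrun
    have h0 := h.sep _ h.pos _ hlt
      (by rw [h.one, inv_one, one_mul, ← mul_inv_eq_iff_eq_mul.2 hrun]
          exact mul_mem ⟨_, rfl⟩ (inv_mem ⟨_, rfl⟩))
    refine ⟨h0.symm, h.injective ?_⟩
    rw [hrun, ← h0, h.one, one_mul]
    rfl
  refine ⟨p, c', ⟨h.rank, h.pos, ?_, by simp [p], ?_, ?_, ?_, ?_, ?_, ?_, ?_⟩⟩
  · rw [List.getD_eq_getElem _ _ (by simpa [c'] using h.pos)]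
    simp [c']
  · intro w hw
    rw [hp, T.2.1.val_gen_of_mem hw, map_one]
  · intro w hw
    obtain ⟨j, -, rfl⟩ := List.mem_map.1 hw
    obtain ⟨v, hv⟩ := (mem_wordSubgroup_iff _).1 (hS.le ⟨T.2.1.gen j, rfl⟩)
    exact ⟨v, by rw [val_append, val_invRev, hv, hf, mul_inv_cancel]⟩
  · intro w hw
    obtain ⟨a, ha⟩ := hS.ge (Subgroup.subset_closure ⟨w, hw, rfl⟩)
    obtain ⟨v, rfl⟩ := T.2.1.exists_val_gen a
    exact ⟨v, by rw [val_append, val_invRev, hp, ha, mul_inv_cancel]⟩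
  · intro l hl i hi
    rw [mem_letters] at hl
    rw [List.mem_range] at hi
    refine ⟨h.lt l hl i hi, ?_⟩
    rw [val_append, val_invRev, mul_inv_eq_one, val_cons, val_append, hc i hi,
      hc _ (h.lt l hl i hi), hp, h.step l hl i hi]
  · intro w hw i hi
    rw [List.mem_range] at hi
    refine hrun w i i hi hi ?_
    rw [mul_eq_right]
    rcases List.mem_append.1 hw with hw | hw
    · exact Q.val_gen_of_mem hw
    · obtain ⟨⟨i, b⟩, -, rfl⟩ := List.mem_map.1 hw
      rw [val_cons]
      cases b <;> simp [val_letter_false]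
  · intro i hi
    rw [List.mem_range] at hi
    exact hrun _ 0 i h.pos hi (by rw [hc i hi, h.one, mul_one])
  · intro j hj
    rw [List.mem_range] at hj
    obtain ⟨h0, h1⟩ := hloc _ _ (hpj ⟨j, hj⟩)
    refine ⟨h0, ?_⟩
    rw [val_append, h1, mul_eq_one_iff_eq_inv, ← val_letter T.2.1.gen ⟨j, hj⟩, val_letter_false,
      inv_inv]

end CosetTable

/-! ### Semidecidability of the table certificates. -/

namespace CosetTable

section

variable {α : Type} [Primcodable α] {P : α → FinPres} {w : α → GWord}

theorem sigmaOne_val_gen_comp (hP : Primrec P) (hw : Primrec w) :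
    SigmaOne fun a => (w a).val (P a).gen = 1 :=
  FinPres.sigmaOne_val_gen_eq_one.comp (f := fun a => (P a, w a)) (hP.pair hw)

variable {T : α → CosetTable} {l : α → ℕ × Bool} {i j : α → ℕ}

theorem look_prim_comp (hT : Primrec T) (hl : Primrec l) (hi : Primrec i) :
    Primrec fun a => (T a).look (l a) (i a) :=
  look_prim.comp (g := fun a => (T a, l a, i a)) (hT.pair (hl.pair hi))

theorem run_prim_comp (hT : Primrec T) (hw : Primrec w) (hi : Primrec i) :
    Primrec fun a => (T a).run (w a) (i a) :=
  run_prim.comp (g := fun a => (T a, w a, i a)) (hT.pair (hw.pair hi))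

theorem sigmaOne_nat_eq (hi : Primrec i) (hj : Primrec j) : SigmaOne fun a => i a = j a :=
  SigmaOne.of_primrec (Primrec.eq.comp hi hj)

end

theorem sigmaOne_tableCert : SigmaOne fun x : ((FinPres × List GWord) × CosetTable) ×
    ℕ × List GWord × List GWord => TableCert x.1.1.1 x.1.1.2 x.1.2 x.2.1 x.2.2.1 x.2.2.2 := by
  let β := ((FinPres × List GWord) × CosetTable) × ℕ × List GWord × List GWord
  have hQ : Primrec fun x : β => x.1.1.1 := Primrec.fst.comp (Primrec.fst.comp Primrec.fst)
  have hS : Primrec fun x : β => x.1.1.2 := Primrec.snd.comp (Primrec.fst.comp Primrec.fst)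
  have hT : Primrec fun x : β => x.1.2 := Primrec.snd.comp Primrec.fst
  have hr : Primrec fun x : β => x.2.1 := Primrec.fst.comp Primrec.snd
  have hp : Primrec fun x : β => x.2.2.1 := Primrec.fst.comp (Primrec.snd.comp Primrec.snd)
  have hc : Primrec fun x : β => x.2.2.2 := Primrec.snd.comp (Primrec.snd.comp Primrec.snd)
  have hP : Primrec fun x : β => x.1.2.2.1 := Primrec.fst.comp (Primrec.snd.comp hT)
  have hrange : Primrec fun x : β => List.range x.2.1 := Primrec.list_range.comp hr
  have hletters : Primrec fun x : β => letters x.1.1.1.1 :=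
    letters_prim.comp (Primrec.fst.comp hQ)
  have hmem (σ : β → List GWord) (hσ : Primrec σ) : SigmaOne fun y : β × GWord =>
      ∃ v, (y.2 ++ FreeGroup.invRev (subst (σ y.1) v)).val y.1.1.1.1.gen = 1 := by
    have hw : Primrec fun z : (β × GWord) × GWord =>
        z.1.2 ++ FreeGroup.invRev (subst (σ z.1.1) z.2) :=
      Primrec.list_append.comp (Primrec.snd.comp Primrec.fst)
        (invRev_prim.comp (subst_prim.comp (hσ.comp (Primrec.fst.comp Primrec.fst)) Primrec.snd))
    exact SigmaOne.ex (sigmaOne_val_gen_comp (hQ.comp (Primrec.fst.comp Primrec.fst)) hw)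
  have rank : SigmaOne fun x : β => x.1.2.1 = x.1.1.1.1 :=
    sigmaOne_nat_eq (Primrec.fst.comp hT) (Primrec.fst.comp hQ)
  have pos : SigmaOne fun x : β => 0 < x.2.1 :=
    SigmaOne.of_primrec (Primrec.nat_lt.comp (Primrec.const 0) hr)
  have one : SigmaOne fun x : β => x.2.2.2.getD 0 [] = [] :=
    SigmaOne.of_primrec (Primrec.eq.comp (getD_prim.comp hc (Primrec.const 0)) (Primrec.const []))
  have length : SigmaOne fun x : β => x.2.2.1.length = x.1.2.2.1.1 :=
    sigmaOne_nat_eq (Primrec.list_length.comp hp) (Primrec.fst.comp hP)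
  have rels := SigmaOne.forall_mem
    (p := fun (x : β) (w : GWord) => (subst x.2.2.1 w).val x.1.1.1.gen = 1)
    (sigmaOne_val_gen_comp (hQ.comp Primrec.fst) (subst_prim.comp (hp.comp Primrec.fst)
      Primrec.snd)) (Primrec.snd.comp hP)
  have le := SigmaOne.forall_mem (p := fun (x : β) (w : GWord) =>
    ∃ v, (w ++ FreeGroup.invRev (subst x.1.1.2 v)).val x.1.1.1.gen = 1) (hmem (fun x => x.1.1.2) hS) hp
  have ge := SigmaOne.forall_mem (p := fun (x : β) (w : GWord) =>
    ∃ v, (w ++ FreeGroup.invRev (subst x.2.2.1 v)).val x.1.1.1.gen = 1) (hmem (fun x => x.2.2.1) hp) hS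
  have step : SigmaOne fun x : β => ∀ l ∈ letters x.1.1.1.1, ∀ i ∈ List.range x.2.1,
      (x.1.2.look l i).1 < x.2.1 ∧
      GWord.val x.1.1.1.gen (l :: x.2.2.2.getD i [] ++ FreeGroup.invRev
        (x.2.2.2.getD (x.1.2.look l i).1 [] ++ subst x.2.2.1 (x.1.2.look l i).2)) = 1 := by
    have h₀ : Primrec fun z : (β × (ℕ × Bool)) × ℕ => z.1.1 := Primrec.fst.comp Primrec.fst
    have hl : Primrec fun z : (β × (ℕ × Bool)) × ℕ => z.1.2 := Primrec.snd.comp Primrec.fst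
    have hi : Primrec fun z : (β × (ℕ × Bool)) × ℕ => z.2 := Primrec.snd
    have hk : Primrec fun z : (β × (ℕ × Bool)) × ℕ => z.1.1.1.2.look z.1.2 z.2 :=
      look_prim_comp (hT.comp h₀) hl hi
    have hw := Primrec.list_append.comp
      (Primrec.list_cons.comp hl (getD_prim.comp (hc.comp h₀) hi))
      (invRev_prim.comp (Primrec.list_append.comp
        (getD_prim.comp (hc.comp h₀) (Primrec.fst.comp hk))
        (subst_prim.comp (hp.comp h₀) (Primrec.snd.comp hk))))
    have h₁ := (SigmaOne.of_primrec (Primrec.nat_lt.comp (Primrec.fst.comp hk) (hr.comp h₀))).and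
      (sigmaOne_val_gen_comp (hQ.comp h₀) hw)
    have h₂ := SigmaOne.forall_mem (p := fun (y : β × (ℕ × Bool)) (i : ℕ) =>
      (y.1.1.2.look y.2 i).1 < y.1.2.1 ∧
      GWord.val y.1.1.1.1.gen (y.2 :: y.1.2.2.2.getD i [] ++ FreeGroup.invRev
        (y.1.2.2.2.getD (y.1.1.2.look y.2 i).1 [] ++ subst y.1.2.2.1 (y.1.1.2.look y.2 i).2)) = 1)
      h₁ (hrange.comp Primrec.fst)
    exact SigmaOne.forall_mem h₂ hletters
  have act : SigmaOne fun x : β => ∀ w ∈ x.1.1.1.2 ++ (letters x.1.1.1.1).map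
      (fun l => [l, (l.1, !l.2)]), ∀ i ∈ List.range x.2.1,
      (x.1.2.run w i).1 = i ∧ (x.1.2.run w i).2.val x.1.2.2.1.gen = 1 := by
    have h₀ : Primrec fun z : (β × GWord) × ℕ => z.1.1 := Primrec.fst.comp Primrec.fst
    have hk : Primrec fun z : (β × GWord) × ℕ => z.1.1.1.2.run z.1.2 z.2 :=
      run_prim_comp (hT.comp h₀) (Primrec.snd.comp Primrec.fst) Primrec.snd
    have h₁ := (sigmaOne_nat_eq (Primrec.fst.comp hk) Primrec.snd).and
      (sigmaOne_val_gen_comp (hP.comp h₀) (Primrec.snd.comp hk))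
    have h₂ := SigmaOne.forall_mem (p := fun (y : β × GWord) (i : ℕ) =>
      (y.1.1.2.run y.2 i).1 = i ∧ (y.1.1.2.run y.2 i).2.val y.1.1.2.2.1.gen = 1)
      h₁ (hrange.comp Primrec.fst)
    have hl : Primrec fun l : ℕ × Bool => [l, (l.1, !l.2)] :=
      Primrec.list_cons.comp Primrec.id (Primrec.list_cons.comp
        (Primrec.fst.pair (Primrec.not.comp Primrec.snd)) (Primrec.const []))
    have hm : Primrec fun x : β => (letters x.1.1.1.1).map fun l => [l, (l.1, !l.2)] :=
      Primrec.list_map hletters (hl.comp Primrec.snd).to₂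
    exact SigmaOne.forall_mem h₂ (Primrec.list_append.comp (Primrec.snd.comp hQ) hm)
  have base := SigmaOne.forall_mem (p := fun (x : β) (i : ℕ) =>
      x.1.2.pos (x.2.2.2.getD i []) = i ∧
        (x.1.2.rewrite (x.2.2.2.getD i [])).val x.1.2.2.1.gen = 1)
    (by
      have hw : Primrec fun y : β × ℕ => y.1.2.2.2.getD y.2 [] :=
        getD_prim.comp (hc.comp Primrec.fst) Primrec.snd
      exact (sigmaOne_nat_eq (pos_prim.comp (hT.comp Primrec.fst) hw) Primrec.snd).and
        (sigmaOne_val_gen_comp (hP.comp Primrec.fst) (rewrite_prim.comp (hT.comp Primrec.fst) hw)))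
    hrange
  have gen := SigmaOne.forall_mem (p := fun (x : β) (j : ℕ) =>
      x.1.2.pos (x.2.2.1.getD j []) = 0 ∧
        (x.1.2.rewrite (x.2.2.1.getD j []) ++ [(j, false)]).val x.1.2.2.1.gen = 1)
    (by
      have hw : Primrec fun y : β × ℕ => y.1.2.2.1.getD y.2 [] :=
        getD_prim.comp (hp.comp Primrec.fst) Primrec.snd
      have hj : Primrec fun y : β × ℕ => [(y.2, false)] :=
        Primrec.list_cons.comp (Primrec.snd.pair (Primrec.const false)) (Primrec.const [])
      exact (sigmaOne_pos_eq (hT.comp Primrec.fst) hw).and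
        (sigmaOne_val_gen_comp (hP.comp Primrec.fst)
          (Primrec.list_append.comp (rewrite_prim.comp (hT.comp Primrec.fst) hw) hj)))
    (Primrec.list_range.comp (Primrec.fst.comp hP))
  have h := rank.and (pos.and (one.and (length.and (rels.and (le.and (ge.and (step.and
    (act.and (base.and gen)))))))))
  refine h.of_eq fun x => ?_
  constructor
  · rintro ⟨h₁, h₂, h₃, h₄, h₅, h₆, h₇, h₈, h₉, h₁₀, h₁₁⟩
    exact ⟨h₁, h₂, h₃, h₄, h₅, h₆, h₇, h₈, h₉, h₁₀, h₁₁⟩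
  · rintro ⟨h₁, h₂, h₃, h₄, h₅, h₆, h₇, h₈, h₉, h₁₀, h₁₁⟩
    exact ⟨h₁, h₂, h₃, h₄, h₅, h₆, h₇, h₈, h₉, h₁₀, h₁₁⟩

/-- `T` is certified to be a coset table of the subgroup generated by `S`. -/
def IsCertified (Q : FinPres) (S : List GWord) (T : CosetTable) : Prop :=
  ∃ y : ℕ × List GWord × List GWord, TableCert Q S T y.1 y.2.1 y.2.2

theorem sigmaOne_isCertified : SigmaOne fun x : (FinPres × List GWord) × CosetTable =>
    IsCertified x.1.1 x.1.2 x.2 :=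
  SigmaOne.ex sigmaOne_tableCert

end CosetTable

/-! ### Assembly of the decision procedures. -/

namespace GroupVariety

variable {V : GroupVariety} {Γ : Type} [Group Γ]

theorem FPMem.of_range {P : FinPres} {ι : P.Grp →* Γ} (hι : Function.Injective ι) {K : Subgroup Γ}
    (hK : ι.range = K) (h : V.FPMem K) : V.FPMem P.Grp := by
  subst hK
  exact ⟨V.image_mem _ _ (MonoidHom.ofInjective hι).symm.toMonoidHom
    (MonoidHom.ofInjective hι).symm.surjective h.1, P.isFinitelyPresented⟩

theorem FPMem.exists_isCosetTable {n : ℕ} (γ : Fin n → Γ) {K : Subgroup Γ} (hf : K.FiniteIndex)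
    (h : V.FPMem K) : ∃ (T : CosetTable) (r : ℕ) (ι : T.2.1.Grp →* Γ) (c : ℕ → Γ),
      T.IsCosetTable r γ ι c ∧ ι.range = K := by
  have := h.2
  obtain ⟨P, ⟨e⟩⟩ := FinPres.exists_mulEquiv K
  have hr : (K.subtype.comp e.toMonoidHom).range = K := by
    rw [MonoidHom.range_comp, MonoidHom.range_eq_top.2 e.surjective, ← MonoidHom.range_eq_map,
      Subgroup.range_subtype]
  obtain ⟨tab, r, c, hT⟩ := CosetTable.exists_isCosetTable γ
    (ι := K.subtype.comp e.toMonoidHom) (K.subtype_injective.comp e.injective) (by rwa [hr])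
  exact ⟨_, r, _, c, hT, hr⟩

end GroupVariety

/-- Each search looks for a table, its certificate and a certificate of the answer at once.
Whichever certified table turns up, its presentation defines a group isomorphic to the given
subgroup, so both algorithms may be applied to it; the promise on the input guarantees that some
table exists. -/
theorem virtuallyPCPDecidable_of_algorithms {V : GroupVariety} (h₁ : EqualiserAlgorithm V)
    (h₂ : ProductMembershipAlgorithm V) : VirtuallyPCPDecidable V := by
  obtain ⟨f₁, hf₁, h₁⟩ := h₁
  obtain ⟨f₂, hf₂, h₂⟩ := h₂
  have hcert : SigmaOne fun x : (FinPres × List GWord × HomPair) × CosetTable =>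
      x.2.IsCertified x.1.1 x.1.2.1 :=
    CosetTable.sigmaOne_isCertified.comp
      (f := fun x : (FinPres × List GWord × HomPair) × CosetTable => ((x.1.1, x.1.2.1), x.2))
      (((Primrec.fst.comp Primrec.fst).pair (Primrec.fst.comp (Primrec.snd.comp Primrec.fst))).pair
        Primrec.snd)
  have hpair : Primrec fun x : (FinPres × List GWord × HomPair) × CosetTable => (x.2, x.1.2.2) :=
    Primrec.snd.pair (Primrec.snd.comp (Primrec.snd.comp Primrec.fst))
  have hpos := SigmaOne.ex (p := fun (a : FinPres × List GWord × HomPair) (T : CosetTable) =>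
    T.IsCertified a.1 a.2.1 ∧ T.PosCert a.2.2 f₁ f₂)
    (hcert.and ((CosetTable.sigmaOne_posCert hf₁ hf₂).comp hpair))
  have hneg := SigmaOne.ex (p := fun (a : FinPres × List GWord × HomPair) (T : CosetTable) =>
    T.IsCertified a.1 a.2.1 ∧ T.NegCert a.2.2 f₂)
    (hcert.and ((CosetTable.sigmaOne_negCert hf₂).comp hpair))
  have hex : ∀ a : FinPres × List GWord × HomPair,
      ((wordSubgroup a.1.gen a.2.1).FiniteIndex ∧ V.FPMem (wordSubgroup a.1.gen a.2.1)) →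
      ∃ T : CosetTable, T.IsCertified a.1 a.2.1 := by
    rintro a ⟨hf, hK⟩
    obtain ⟨T, r, ι, c, hT, hr⟩ := hK.exists_isCosetTable a.1.gen hf
    obtain ⟨p, c', h⟩ := hT.exists_tableCert hr
    exact ⟨T, (r, p, c'), h⟩
  have hloc : ∀ a : FinPres × List GWord × HomPair,
      ((wordSubgroup a.1.gen a.2.1).FiniteIndex ∧ V.FPMem (wordSubgroup a.1.gen a.2.1)) →
      ∀ T : CosetTable, T.IsCertified a.1 a.2.1 →
        V.FPMem T.2.1.Grp ∧ ∃ ι, T.Locates a.1.gen ι := by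
    rintro a ⟨hf, hK⟩ T ⟨y, hy⟩
    obtain ⟨ι, hT, hr⟩ := hy.exists_isCosetTable
    exact ⟨hK.of_range hT.injective hr, ι, hT.locates (hr ▸ hf)⟩
  refine DecidableOn.of_sigmaOne hpos hneg (fun a ha => ?_) fun a ha => ?_
  · constructor
    · rintro ⟨T, hT, h⟩
      obtain ⟨hV, ι, hι⟩ := hloc a ha T hT
      exact hι.pcpTrivial_of_posCert hV h₁ h₂ h
    · intro h
      obtain ⟨T, hT⟩ := hex a ha
      obtain ⟨hV, ι, hι⟩ := hloc a ha T hT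
      exact ⟨T, hT, hι.posCert_of_pcpTrivial hV h₁ h₂ h⟩
  · constructor
    · rintro ⟨T, hT, h⟩
      obtain ⟨hV, ι, hι⟩ := hloc a ha T hT
      exact (hι.negCert_iff hV h₂).1 h
    · intro h
      obtain ⟨T, hT⟩ := hex a ha
      obtain ⟨hV, ι, hι⟩ := hloc a ha T hT
      exact ⟨T, hT, (hι.negCert_iff hV h₂).2 h⟩

/-- For a fixed group one correct table is built into the algorithm as a constant. It is neither
searched for nor certified, so no presentation of `Γ` enters. -/
theorem pcpDecidableFor_of_algorithms {V : GroupVariety} (h₁ : EqualiserAlgorithm V)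
    (h₂ : ProductMembershipAlgorithm V) {Γ : Type} [Group Γ] {n : ℕ} (γ : Fin n → Γ)
    {K : Subgroup Γ} (hf : K.FiniteIndex) (hK : V.FPMem K) : PCPDecidableFor γ := by
  obtain ⟨f₁, hf₁, h₁⟩ := h₁
  obtain ⟨f₂, hf₂, h₂⟩ := h₂
  obtain ⟨T, r, ι, c, hT, hr⟩ := hK.exists_isCosetTable γ hf
  have hV := hK.of_range hT.injective hr
  have hι := hT.locates (hr ▸ hf)
  have hpair : Primrec fun L : HomPair => (T, L) := (Primrec.const T).pair Primrec.id
  refine ComputablePred.computable_iff_re_compl_re'.2 ⟨?_, ?_⟩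
  · refine ((CosetTable.sigmaOne_posCert hf₁ hf₂).comp hpair).rePred.of_eq fun L => ?_
    exact ⟨hι.pcpTrivial_of_posCert hV h₁ h₂, hι.posCert_of_pcpTrivial hV h₁ h₂⟩
  · exact ((CosetTable.sigmaOne_negCert hf₂).comp hpair).rePred.of_eq fun L => hι.negCert_iff hV h₂

theorem theorem5p3 (V : GroupVariety) (hV : V.IsFPVariety)
    (h₁ : EqualiserAlgorithm V) (h₂ : ProductMembershipAlgorithm V) :
    VirtuallyPCPDecidable V ∧
      ∀ (Γ : Type) [Group Γ] (n : ℕ) (γ : Fin n → Γ),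
        Subgroup.closure (Set.range γ) = ⊤ →
        (∃ K : Subgroup Γ, K.FiniteIndex ∧ V.FPMem K) →
        PCPDecidableFor γ :=
  ⟨virtuallyPCPDecidable_of_algorithms h₁ h₂, fun _ _ _ γ _ ⟨_, hf, hK⟩ =>
    pcpDecidableFor_of_algorithms h₁ h₂ γ hf hK⟩
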